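/- For a left vector space $V$ over a division ring $D$, let $P(V)$ be the set of all subspaces of $V$ and $P^*(V)=P(V)\setminus\{0,V\}$. Let $\mathrm{PGL}(V)$ be the group, under composition, of all permutations $L\mapsto gL$ of $P(V)$ induced by linear automorphisms $g\in\mathrm{GL}(V)$ (for $\dim V\ge 2$ this is $\mathrm{GL}(V)$ modulo its centre). Let $\langle \mathrm{PGL}(V),P^*(V);\circ,B,act\rangle$ be the two-sorted structure whose basic relations are the composition of $\mathrm{PGL}(V)$, the betweenness relation $B(L_0,L_1,L_2)\Leftrightarrow (L_0\subseteq L_1\subseteq L_2)\vee(L_0\supseteq L_1\supseteq L_2)$ on $P^*(V)$, and the ternary relation $act(\varphi,L,L')\Leftrightarrow \varphi L=L'$ of the action of $\mathrm{PGL}(V)$ on $P^*(V)$. A multi-sorted structure is treated as the one-sorted structure on the disjoint union of its sorts, with a unary predicate for each sort. A structure $\mathcal M$ is interpretable without parameters (by first-order logic) in a structure $\mathcal N$ if there are a positive integer $n$, a set $X$ of $n$-tuples of $\mathcal N$ that is first-order definable without parameters, and a surjection $f:X\to\mathcal M$ such that the $f$-preimages of equality and of all basic relations of $\mathcal M$ are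 first-order definable in $\mathcal N$ without parameters. For a family of pairs $(\mathcal M,\mathcal N)$ the interpretation is uniform if $n$ and all the defining formulas are the same for all pairs of the family. **Theorem.** Uniformly over all division rings $D$ and all infinite-dimensional left vector spaces $V$ over $D$ (of arbitrary infinite dimension): 1. the structure $\langle \mathrm{PGL}(V),P^*(V);\circ,B,act\rangle$ is interpretable without parameters in the group $\mathrm{PGL}(V)$ by first-order logic; 2. the projective space $\langle P(V);\subseteq\rangle$ is interpretable without parameters in the group $\mathrm{PGL}(V)$ by first-order logic. -/

import Mathlib

universe u v
open scoped Pointwise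

namespace ProjRec

section Interpretations

variable (L L' : FirstOrder.Language.{0, 0})

/-- The syntactic data of an interpretation without parameters of `L`-structures in
`L'`-structures: a positive length `n` of tuples, an `L'`-formula defining the set of
admissible `n`-tuples, an `L'`-formula for equality, an `L'`-formula for every relation symbol
and an `L'`-formula for the graph of every function symbol. -/
structure Interpretation where
  /-- the length of the coding tuples -/
  n : ℕ
  n_pos : 0 < n
  /-- defines the set of coding tuples -/
  dom : L'.Formula (Fin n)
  /-- defines the preimage of equality -/
  eqv : L'.Formula (Fin n ⊕ Fin n)
  /-- defines the preimage of a basic relation -/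
  rel : ∀ {k : ℕ}, L.Relations k → L'.Formula (Fin k × Fin n)
  /-- defines the preimage of the graph of a basic operation; the last tuple is the value -/
  graph : ∀ {k : ℕ}, L.Functions k → L'.Formula (Fin (k + 1) × Fin n)

variable {L L'}

namespace Interpretation

/-- The set of `n`-tuples of `N` that satisfy the domain formula. -/
def Dom (I : Interpretation L L') (N : Type*) [L'.Structure N] : Set (Fin I.n → N) :=
  {a | I.dom.Realize a}

/-- The formulas of `I` interpret the `L`-structure `M` in the `L'`-structure `N`: there is a
surjective map from the set of coding tuples onto `M` such that the preimages of equality and of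
all basic relations and operations of `M` are defined by the formulas of `I`. -/
def Interprets (I : Interpretation L L') (M N : Type*) [L.Structure M] [L'.Structure N] : Prop :=
  ∃ f : I.Dom N → M, Function.Surjective f ∧
    (∀ a b : I.Dom N, I.eqv.Realize (Sum.elim a.1 b.1) ↔ f a = f b) ∧
    (∀ (k : ℕ) (R : L.Relations k) (a : Fin k → I.Dom N),
      (I.rel R).Realize (fun p => (a p.1).1 p.2) ↔
        FirstOrder.Language.Structure.RelMap R (fun i => f (a i))) ∧
    (∀ (k : ℕ) (F : L.Functions k) (a : Fin k → I.Dom N) (b : I.Dom N),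
      (I.graph F).Realize
          (fun p => (Fin.snoc (α := fun _ => I.Dom N) a b p.1).1 p.2) ↔
        FirstOrder.Language.Structure.funMap F (fun i => f (a i)) = f b)

end Interpretation

end Interpretations

section Groups

/-- The function symbols of the language of groups. -/
inductive GroupFunc : ℕ → Type
  | mul : GroupFunc 2
  | inv : GroupFunc 1
  | one : GroupFunc 0

/-- The first-order language of groups. -/
def groupLang : FirstOrder.Language.{0, 0} where
  Functions := GroupFunc
  Relations := fun _ => Empty

/-- Every group is a structure for the language of groups. -/
instance groupStructure (G : Type*) [Group G] : groupLang.Structure G where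
  funMap {_} F x :=
    match F, x with
    | .mul, x => x 0 * x 1
    | .inv, x => (x 0)⁻¹
    | .one, _ => 1
  RelMap {_} R _ := nomatch R

end Groups

section ProjectiveGroup

variable (D V : Type*) [DivisionRing D] [AddCommGroup V] [Module D V]

/-- The projective image of a linear automorphism `g` of `V`: the permutation `L ↦ g L` of the
set of all subspaces of `V`. -/
def projImage : (V ≃ₗ[D] V) →* Equiv.Perm (Submodule D V) :=
  MulAction.toPermHom (V ≃ₗ[D] V) (Submodule D V)

theorem projImage_apply (g : V ≃ₗ[D] V) (L : Submodule D V) :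
    projImage D V g L = L.map (g : V →ₗ[D] V) := rfl

/-- The projective general linear group: the group of the projective images of all
linear automorphisms of `V`, under composition. -/
def PGL : Subgroup (Equiv.Perm (Submodule D V)) := (projImage D V).range

/-- The set of proper non-zero subspaces of `V`. -/
def PStar : Type _ := {L : Submodule D V // L ≠ ⊥ ∧ L ≠ ⊤}

variable {D V}

/-- The betweenness relation on the proper non-zero subspaces. -/
def Between (L₀ L₁ L₂ : PStar D V) : Prop :=
  (L₀.1 ≤ L₁.1 ∧ L₁.1 ≤ L₂.1) ∨ (L₀.1 ≥ L₁.1 ∧ L₁.1 ≥ L₂.1)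

end ProjectiveGroup

section TwoSorted

/-- The relation symbols for the two-sorted structure `⟨PGL(V), P*(V); ∘, B, act⟩`: a unary
predicate for each of the two sorts, the graph of the composition, betweenness, and the action. -/
inductive PGRel : ℕ → Type
  | group : PGRel 1
  | space : PGRel 1
  | comp : PGRel 3
  | betw : PGRel 3
  | act : PGRel 3

/-- The language of `⟨PGL(V), P*(V); ∘, B, act⟩`. -/
def pgLang : FirstOrder.Language.{0, 0} where
  Functions := fun _ => Empty
  Relations := PGRel

variable (D V : Type*) [DivisionRing D] [AddCommGroup V] [Module D V]

/-- The underlying set of `⟨PGL(V), P*(V); ∘, B, act⟩`: the disjoint union of the two sorts. -/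
def PG : Type _ := PGL D V ⊕ PStar D V

/-- The two-sorted structure `⟨PGL(V), P*(V); ∘, B, act⟩`, as a one-sorted structure with
predicates for the sorts. -/
instance pgStructure : pgLang.Structure (PG D V) where
  funMap {_} F _ := nomatch F
  RelMap {_} R x :=
    match R, x with
    | .group, x => ∃ φ : PGL D V, x 0 = Sum.inl φ
    | .space, x => ∃ S : PStar D V, x 0 = Sum.inr S
    | .comp, x => ∃ φ ψ : PGL D V,
        x 0 = Sum.inl φ ∧ x 1 = Sum.inl ψ ∧ x 2 = Sum.inl (φ * ψ)
    | .betw, x => ∃ S₀ S₁ S₂ : PStar D V,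
        x 0 = Sum.inr S₀ ∧ x 1 = Sum.inr S₁ ∧ x 2 = Sum.inr S₂ ∧ Between S₀ S₁ S₂
    | .act, x => ∃ (φ : PGL D V) (S T : PStar D V),
        x 0 = Sum.inl φ ∧ x 1 = Sum.inr S ∧ x 2 = Sum.inr T ∧ φ.1 S.1 = T.1

end TwoSorted

section ProjectiveSpace

/-- The projective space `⟨P(V); ⊆⟩`: all subspaces of `V` with inclusion, in the language with
one binary relation symbol. -/
instance projStructure (D V : Type*) [DivisionRing D] [AddCommGroup V] [Module D V] :
    FirstOrder.Language.order.Structure (Submodule D V) :=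
  FirstOrder.Language.orderStructure (Submodule D V)

end ProjectiveSpace

end ProjRec

/-!
The interpretations rest on a first-order definition, in the group `PGL(V)`, of an encoding of all
subspaces of `V` by group elements.

*Transvections.* Since `V` has infinite dimension, an element of finite rank has non-zero fixed
vectors, and equations between such elements lift from `PGL(V)` to `GL(V)` (`eq_of_proj_eq`).
The double commutators that can be produced from every non-trivial element include all
transvections and have finite rank (`Core`). A further round of commutators cuts the rank down to
at most two, a second one ensures that the products of commuting transvections are retained
(`commOf_pair`), and a condition on products of commuting conjugates excludes rank two. This defines
the transvections, by the predicate `IsTv` (`isTv_iff`).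

*Incidence.* A transvection has a centre `p` (a point), and an axis `H` (a hyperplane) with `p ≤ H`.
The quotient of two transvections is a transvection or trivial if and only if they have the same
centre or the same axis (`adj_iff`). A pair of transvections with exactly one of the two in common
represents a centre or an axis (`isCode_iff`). Given such a pair as a parameter, equality of centres
and equality of axes are definable, up to the interchange of the two notions (`PartEq`, `CoPartEq`).

*Orientation.* The interchange is a duality between points and hyperplanes, and the space is not
isomorphic to its dual. A chain of subspaces has a subspace as its union, so the union is the
intersection of the hyperplanes through it. The dual statement fails: a linear form that vanishes
on the intersection of a descending chain of subspaces need not vanish on a member of the chain.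
This failure is witnessed inside the group by a shift `g` of a basis partly indexed by `ℤ`: the
centralizer of `g` moves the fixed space of a suitable element `k` through all tails of the basis,
and only through them. Hence the parameters that represent centres are definable
(`IsCentreCode.not_bad`, `IsAxisCode.bad`).

*Encoding.* The element `k` encodes the intersection `fixInf k` of all hyperplanes fixed by `k`. If
`k` is induced by `1 + N` for a locally nilpotent endomorphism `N`, then this is the range of `N`
(`fixInf_oneAdd`), and every subspace is such a range (`fixInf_surjective`). Inclusion of encoded
subspaces is defined by `Le` (`le_iff_fixInf_le`), and conjugation of codes is the action of the
group on subspaces (`fixInf_conj`). All these formulas are independent of `D` and `V`.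
-/

open scoped commutatorElement

namespace ProjRec

/-! ### The projective group and fixed vectors -/

section Basic

open Module Submodule

variable {D V : Type*} [DivisionRing D] [AddCommGroup V] [Module D V]

/-- The canonical epimorphism from the general linear group onto the projective group. -/
def proj : (V ≃ₗ[D] V) →* PGL D V := (projImage D V).rangeRestrict

theorem proj_surjective : Function.Surjective (proj (D := D) (V := V)) :=
  MonoidHom.rangeRestrict_surjective _

theorem proj_apply (g : V ≃ₗ[D] V) (L : Submodule D V) :
    (proj g).1 L = L.map (g : V →ₗ[D] V) := rfl

theorem proj_eq_one_iff {g : V ≃ₗ[D] V} : proj g = 1 ↔ ∀ x, g x ∈ span D {x} := by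
  constructor
  · intro h x
    have h1 : (proj g).1 (span D {x}) = span D {x} := by rw [h]; rfl
    rw [proj_apply, map_span, Set.image_singleton] at h1
    rw [← h1]
    exact mem_span_singleton_self _
  · intro h
    apply Subtype.ext
    apply Equiv.ext
    intro L
    rw [proj_apply]
    change _ = L
    apply le_antisymm
    · rintro _ ⟨x, hx, rfl⟩
      exact (span_singleton_le_iff_mem x L).2 hx (h x)
    · intro x hx
      obtain ⟨c, hc⟩ := mem_span_singleton.1 (h x)
      by_cases hx0 : x = 0
      · rw [hx0]; exact zero_mem _
      have hc0 : c ≠ 0 := by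
        rintro rfl
        rw [zero_smul] at hc
        exact hx0 (g.map_eq_zero_iff.1 hc.symm)
      refine ⟨c⁻¹ • x, L.smul_mem _ hx, ?_⟩
      simp only [LinearEquiv.coe_coe, map_smul]
      rw [← hc, smul_smul, inv_mul_cancel₀ hc0, one_smul]

theorem exists_notMem_span_of_proj_ne_one {g : V ≃ₗ[D] V} (h : proj g ≠ 1) :
    ∃ x, g x ∉ span D {x} := by
  by_contra! H
  exact h (proj_eq_one_iff.2 H)

/-- An automorphism that fixes every line and some non-zero vector is the identity; hence
equations between elements with a common fixed vector lift from the projective group. -/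
theorem eq_one_of_proj_eq_one {q : V ≃ₗ[D] V} (h : proj q = 1) {w : V} (hw : w ≠ 0)
    (hq : q w = w) : q = 1 := by
  rw [proj_eq_one_iff] at h
  ext x
  change q x = x
  by_cases hx : x ∈ span D {w}
  · obtain ⟨c, rfl⟩ := mem_span_singleton.1 hx
    rw [map_smul, hq]
  · obtain ⟨c, hc⟩ := mem_span_singleton.1 (h x)
    obtain ⟨d, hd⟩ := mem_span_singleton.1 (h (x + w))
    rw [map_add, hq, ← hc, smul_add] at hd
    have h1 : (c - d) • x = (d - 1) • w := by
      rw [sub_smul, sub_smul, one_smul]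
      rw [← sub_eq_zero] at hd ⊢
      rw [← neg_eq_zero, ← hd]; abel
    have hcd : c - d = 0 := by
      by_contra hne
      apply hx
      rw [mem_span_singleton]
      refine ⟨(c - d)⁻¹ * (d - 1), ?_⟩
      rw [mul_smul, ← h1, smul_smul, inv_mul_cancel₀ hne, one_smul]
    rw [hcd, zero_smul] at h1
    have hd1 : d - 1 = 0 := (smul_eq_zero.1 h1.symm).resolve_right hw
    rw [← hc, sub_eq_zero.1 hcd, sub_eq_zero.1 hd1, one_smul]

theorem eq_of_proj_eq {a b : V ≃ₗ[D] V} (h : proj a = proj b) {w : V} (hw : w ≠ 0)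
    (ha : a w = w) (hb : b w = w) : a = b := by
  have : b⁻¹ * a = 1 := by
    refine eq_one_of_proj_eq_one (by rw [map_mul, map_inv, h, inv_mul_cancel]) hw ?_
    rw [LinearEquiv.mul_apply, ha]
    exact (LinearEquiv.symm_apply_eq b).2 hb.symm
  exact (inv_mul_eq_one.1 this).symm

/-- The residual space of an automorphism `g`: the range of `g - 1`. -/
def res (g : V ≃ₗ[D] V) : Submodule D V := LinearMap.range ((g : V →ₗ[D] V) - LinearMap.id)

theorem sub_mem_res (g : V ≃ₗ[D] V) (x : V) : g x - x ∈ res g := ⟨x, rfl⟩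

theorem res_le_iff {g : V ≃ₗ[D] V} {F : Submodule D V} : res g ≤ F ↔ ∀ x, g x - x ∈ F :=
  ⟨fun h x => h (sub_mem_res g x), by rintro h _ ⟨x, rfl⟩; exact h x⟩

theorem res_mul_le (a b : V ≃ₗ[D] V) : res (a * b) ≤ res a ⊔ res b := by
  rw [res_le_iff]
  intro x
  have : (a * b) x - x = (a (b x) - b x) + (b x - x) := by rw [LinearEquiv.mul_apply]; abel
  rw [this]
  exact add_mem_sup (sub_mem_res a _) (sub_mem_res b _)

theorem res_inv (a : V ≃ₗ[D] V) : res a⁻¹ = res a := by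
  have key : ∀ a : V ≃ₗ[D] V, res a⁻¹ ≤ res a := by
    intro a
    rw [res_le_iff]
    intro x
    have : a⁻¹ x - x = -(a (a⁻¹ x) - a⁻¹ x) := by
      rw [← LinearEquiv.mul_apply, mul_inv_cancel]; simp
    rw [this]
    exact neg_mem (sub_mem_res a _)
  exact le_antisymm (key a) (by simpa using key a⁻¹)

theorem res_conj (k a : V ≃ₗ[D] V) : res (k * a * k⁻¹) = (res a).map (k : V →ₗ[D] V) := by
  apply le_antisymm
  · rw [res_le_iff]
    intro x
    refine ⟨a (k⁻¹ x) - k⁻¹ x, sub_mem_res a _, ?_⟩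
    simp
  · rintro _ ⟨_, ⟨x, rfl⟩, rfl⟩
    refine ⟨k x, ?_⟩
    have : k⁻¹ (k x) = x := by rw [← LinearEquiv.mul_apply, inv_mul_cancel]; rfl
    simp [this]

theorem exists_mem_ker_notMem (hV : ¬ Module.Finite D V) {W : Type*} [AddCommGroup W] [Module D W]
    (N : V →ₗ[D] W) [Module.Finite D (LinearMap.range N)] (F : Submodule D V)
    [Module.Finite D F] : ∃ w, N w = 0 ∧ w ∉ F := by
  by_contra! H
  have hle : LinearMap.ker N ≤ F := fun w hw => H w hw
  have : Module.Finite D (LinearMap.ker N) := Module.Finite.of_injective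
    (Submodule.inclusion hle) (Submodule.inclusion_injective hle)
  have : Module.Finite D (V ⧸ LinearMap.ker N) :=
    Module.Finite.equiv (LinearMap.quotKerEquivRange N).symm
  exact hV (Module.Finite.of_submodule_quotient (LinearMap.ker N))

theorem exists_notMem_of_finite (hV : ¬ Module.Finite D V) (F : Submodule D V)
    [Module.Finite D F] : ∃ w, w ∉ F := by
  by_contra! H
  rw [← Submodule.eq_top_iff'] at H
  subst H
  exact hV (Module.Finite.equiv Submodule.topEquiv)

theorem exists_fixed_notMem (hV : ¬ Module.Finite D V) (a : V ≃ₗ[D] V)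
    [Module.Finite D (res a)] (F : Submodule D V)
    [Module.Finite D F] : ∃ w, a w = w ∧ w ∉ F := by
  have : Module.Finite D (LinearMap.range ((a : V →ₗ[D] V) - LinearMap.id)) :=
    inferInstanceAs (Module.Finite D (res a))
  obtain ⟨w, h, hF⟩ := exists_mem_ker_notMem hV ((a : V →ₗ[D] V) - LinearMap.id) F
  exact ⟨w, sub_eq_zero.1 h, hF⟩

theorem exists_common_fixed (hV : ¬ Module.Finite D V) (a b : V ≃ₗ[D] V)
    [Module.Finite D (res a)] [Module.Finite D (res b)] : ∃ w ≠ 0, a w = w ∧ b w = w := by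
  set A := (a : V →ₗ[D] V) - LinearMap.id
  set B := (b : V →ₗ[D] V) - LinearMap.id
  have : Module.Finite D (LinearMap.range A) := inferInstanceAs (Module.Finite D (res a))
  have : Module.Finite D (LinearMap.range B) := inferInstanceAs (Module.Finite D (res b))
  obtain ⟨w, hw, hw0⟩ := exists_mem_ker_notMem hV (A.rangeRestrict.prod B.rangeRestrict) ⊥
  have hw' := Prod.ext_iff.1 hw
  exact ⟨w, by simpa using hw0, sub_eq_zero.1 (congrArg Subtype.val hw'.1),
    sub_eq_zero.1 (congrArg Subtype.val hw'.2)⟩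

end Basic


/-! ### Transvections -/

section Transvections

open Module Submodule

variable {D V : Type*} [DivisionRing D] [AddCommGroup V] [Module D V]

open Classical in
/-- The transvection `x ↦ x + φ x • v` for `φ v = 0`; by convention `1` if `φ v ≠ 0`. -/
noncomputable def tv (φ : Dual D V) (v : V) : V ≃ₗ[D] V :=
  if h : φ v = 0 then LinearEquiv.transvection h else 1

theorem tv_apply {φ : Dual D V} {v : V} (h : φ v = 0) (x : V) : tv φ v x = x + φ x • v := by
  rw [tv, dif_pos h]; rfl

theorem tv_eq_one_iff {φ : Dual D V} {v : V} (h : φ v = 0) : tv φ v = 1 ↔ φ = 0 ∨ v = 0 := by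
  constructor
  · intro H
    by_contra! hne
    obtain ⟨x, hx⟩ := DFunLike.ne_iff.1 hne.1
    have := tv_apply h x
    rw [H] at this
    exact (smul_ne_zero hx hne.2) (left_eq_add.1 this)
  · rintro (rfl | rfl) <;> ext x <;> rw [tv_apply h] <;> simp

theorem conj_tv (k : V ≃ₗ[D] V) (φ : Dual D V) (v : V) :
    k * tv φ v * k⁻¹ = tv (φ ∘ₗ (k⁻¹ : V ≃ₗ[D] V).toLinearMap) (k v) := by
  have hk : ∀ x, k⁻¹ (k x) = x := fun x => k.symm_apply_apply x
  have hk' : ∀ x, k (k⁻¹ x) = x := fun x => k.apply_symm_apply x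
  by_cases h : φ v = 0
  · have h' : (φ ∘ₗ (k⁻¹ : V ≃ₗ[D] V).toLinearMap) (k v) = 0 := by simpa [hk] using h
    ext x
    rw [LinearEquiv.mul_apply, LinearEquiv.mul_apply, tv_apply h, tv_apply h', map_add, hk',
      map_smul]
    rfl
  · have h' : ¬ (φ ∘ₗ (k⁻¹ : V ≃ₗ[D] V).toLinearMap) (k v) = 0 := by simpa [hk] using h
    rw [tv, dif_neg h, tv, dif_neg h', mul_one, mul_inv_cancel]

theorem tv_mul_left {φ ψ : Dual D V} {v : V} (h : φ v = 0) (h' : ψ v = 0) :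
    tv φ v * tv ψ v = tv (φ + ψ) v := by
  have h2 : (φ + ψ) v = 0 := by simp [h, h']
  ext x
  rw [LinearEquiv.mul_apply, tv_apply h', tv_apply h, tv_apply h2]
  simp [h, add_smul]; abel

theorem tv_mul_right {φ : Dual D V} {v w : V} (h : φ v = 0) (h' : φ w = 0) :
    tv φ v * tv φ w = tv φ (v + w) := by
  have h2 : φ (v + w) = 0 := by simp [h, h']
  ext x
  rw [LinearEquiv.mul_apply, tv_apply h', tv_apply h, tv_apply h2]
  simp [h', smul_add]; abel

theorem tv_inv {φ : Dual D V} {v : V} (h : φ v = 0) : (tv φ v)⁻¹ = tv (-φ) v := by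
  rw [inv_eq_iff_mul_eq_one, tv_mul_left h (by simpa using h), add_neg_cancel,
    tv_eq_one_iff (by simp)]
  exact Or.inl rfl

theorem tv_commute {φ ψ : Dual D V} {v w : V} (hφ : φ v = 0) (hψ : ψ w = 0) (h : φ w = 0)
    (h' : ψ v = 0) : tv φ v * tv ψ w = tv ψ w * tv φ v := by
  ext x
  simp only [LinearEquiv.mul_apply, tv_apply hφ, tv_apply hψ, map_add, map_smul, h, h',
    add_zero, smul_eq_mul, mul_zero]
  abel

theorem res_tv_le (φ : Dual D V) (v : V) : res (tv φ v) ≤ span D {v} := by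
  rw [res_le_iff]
  intro x
  by_cases h : φ v = 0
  · rw [tv_apply h, add_sub_cancel_left]
    exact smul_mem _ _ (mem_span_singleton_self v)
  · rw [tv, dif_neg h]
    simp

theorem finite_of_le {F F' : Submodule D V} (h : F ≤ F') [Module.Finite D F'] :
    Module.Finite D F :=
  Module.Finite.of_injective (Submodule.inclusion h) (Submodule.inclusion_injective h)

theorem finite_res_tv (φ : Dual D V) (v : V) : Module.Finite D (res (tv φ v)) :=
  finite_of_le (res_tv_le φ v)

theorem finite_res_mul (a b : V ≃ₗ[D] V) [Module.Finite D (res a)] [Module.Finite D (res b)] :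
    Module.Finite D (res (a * b)) := finite_of_le (res_mul_le a b)

theorem finite_res_inv (a : V ≃ₗ[D] V) [Module.Finite D (res a)] : Module.Finite D (res a⁻¹) := by
  rwa [res_inv]

theorem finite_res_conj (k a : V ≃ₗ[D] V) [Module.Finite D (res a)] :
    Module.Finite D (res (k * a * k⁻¹)) := by
  rw [res_conj]; exact Module.Finite.map _ _

/-! ### Transitivity on systems of commuting transvections -/

theorem rank_eq_of_finite_quotient (hV : ¬ Module.Finite D V) (R : Submodule D V)
    [Module.Finite D (V ⧸ R)] : Module.rank D R = Module.rank D V := by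
  have hR : ¬ Module.Finite D R := fun h => hV (Module.Finite.of_submodule_quotient R)
  have h1 : Cardinal.aleph0 ≤ Module.rank D R := by
    rw [← not_lt, Module.rank_lt_aleph0_iff]; exact hR
  have h2 : Module.rank D (V ⧸ R) < Cardinal.aleph0 := Module.rank_lt_aleph0_iff.2 inferInstance
  rw [← Submodule.rank_quotient_add_rank R, Cardinal.add_eq_right h1 (h2.le.trans h1)]

/-- A splitting of the space along independent vectors `w i` and linear forms `α i` with dual
vectors `u i` that vanish on all `w i`. -/
theorem exists_frame {n : ℕ} (w u : Fin n → V) (α : Fin n → Dual D V)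
    (hw : LinearIndependent D w) (hu : ∀ i j, α i (u j) = if i = j then 1 else 0)
    (hαw : ∀ i j, α i (w j) = 0) :
    ∃ (R : Submodule D V) (Φ : ((Fin n → D) × (Fin n → D) × R) ≃ₗ[D] V),
      Module.Finite D (V ⧸ R) ∧ (∀ i, Φ (Pi.single i 1, 0, 0) = w i) ∧
      ∀ i x, α i (Φ x) = x.2.1 i := by
  classical
  set K : Submodule D V := LinearMap.ker (LinearMap.pi α)
  have hwK : span D (Set.range w) ≤ K := by
    rw [span_le]
    rintro _ ⟨j, rfl⟩
    change LinearMap.pi α (w j) = 0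
    ext i
    exact hαw i j
  obtain ⟨R, hR1, hR2⟩ := IsModularLattice.exists_disjoint_and_sup_eq hwK
  have hRK : ∀ r ∈ R, ∀ i, α i r = 0 := fun r hr i =>
    congrFun (show LinearMap.pi α r = 0 from (hR2 ▸ le_sup_right : R ≤ K) hr) i
  let Ψ : ((Fin n → D) × (Fin n → D) × R) →ₗ[D] V :=
    (Fintype.linearCombination D w).coprod ((Fintype.linearCombination D u).coprod R.subtype)
  have hΨ : ∀ a b r, Ψ (a, b, r) = ∑ i, a i • w i + (∑ i, b i • u i + r) := fun a b r => by
    simp [Ψ, Fintype.linearCombination_apply]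
  have hα : ∀ i x, α i (Ψ x) = x.2.1 i := by
    rintro i ⟨a, b, r⟩
    rw [hΨ]
    simp [hαw, hu, hRK r.1 r.2]
  have hbij : Function.Bijective Ψ := by
    constructor
    · rw [← LinearMap.ker_eq_bot, LinearMap.ker_eq_bot']
      rintro ⟨a, b, r⟩ h
      have hb : b = 0 := by
        ext i
        change (a, b, r).2.1 i = 0
        rw [← hα i (a, b, r), h, map_zero]
      subst hb
      rw [hΨ] at h
      simp only [Pi.zero_apply, zero_smul, Finset.sum_const_zero, zero_add] at h
      have hr : (r : V) = 0 := by
        refine (Submodule.disjoint_def.1 hR1) r ?_ r.2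
        rw [← neg_eq_iff_add_eq_zero.2 h]
        exact neg_mem (sum_mem fun i _ => smul_mem _ _ (subset_span ⟨i, rfl⟩))
      rw [hr, add_zero] at h
      have ha : a = 0 := funext (Fintype.linearIndependent_iff.1 hw a h)
      rw [ha, show r = 0 from Subtype.ext hr]
      rfl
    · intro v
      have hv : v - ∑ i, α i v • u i ∈ span D (Set.range w) ⊔ R := by
        rw [hR2]
        change LinearMap.pi α _ = 0
        ext i
        simp [hu]
      obtain ⟨y, hy, r, hr, hyr⟩ := mem_sup.1 hv
      obtain ⟨a, rfl⟩ := (mem_span_range_iff_exists_fun D).1 hy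
      refine ⟨(a, fun i => α i v, ⟨r, hr⟩), ?_⟩
      rw [hΨ]
      simp only
      rw [add_left_comm, hyr]; abel
  refine ⟨R, LinearEquiv.ofBijective Ψ hbij, ?_, ?_, hα⟩
  · have hsurj : Function.Surjective (R.mkQ ∘ₗ (Fintype.linearCombination D w).coprod
        (Fintype.linearCombination D u)) := by
      intro q
      obtain ⟨v, rfl⟩ := R.mkQ_surjective q
      obtain ⟨⟨a, b, r⟩, rfl⟩ := hbij.2 v
      refine ⟨(a, b), ?_⟩
      rw [LinearMap.comp_apply, ← sub_eq_zero, ← map_sub, mkQ_apply, Quotient.mk_eq_zero]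
      rw [hΨ]
      simp only [LinearMap.coprod_apply, Fintype.linearCombination_apply]
      rw [show ∑ i, a i • w i + ∑ i, b i • u i - (∑ i, a i • w i + (∑ i, b i • u i + (r : V)))
        = -(r : V) by abel]
      exact neg_mem r.2
    exact Module.Finite.of_surjective _ hsurj
  · intro i
    change Ψ _ = _
    rw [hΨ]
    simp [Pi.single_apply]

theorem exists_map_frame (hV : ¬ Module.Finite D V) {n : ℕ} {w u w' u' : Fin n → V}
    {α α' : Fin n → Dual D V}
    (hw : LinearIndependent D w) (hu : ∀ i j, α i (u j) = if i = j then 1 else 0)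
    (hαw : ∀ i j, α i (w j) = 0)
    (hw' : LinearIndependent D w') (hu' : ∀ i j, α' i (u' j) = if i = j then 1 else 0)
    (hαw' : ∀ i j, α' i (w' j) = 0) :
    ∃ g : V ≃ₗ[D] V, ∀ i, g (w i) = w' i ∧ α i ∘ₗ (g⁻¹ : V ≃ₗ[D] V).toLinearMap = α' i := by
  obtain ⟨R, Φ, _, hΦ, hα⟩ := exists_frame w u α hw hu hαw
  obtain ⟨R', Φ', _, hΦ', hα'⟩ := exists_frame w' u' α' hw' hu' hαw'
  obtain ⟨e⟩ := Module.nonempty_linearEquiv_iff_rank_eq.2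
    ((rank_eq_of_finite_quotient hV R).trans (rank_eq_of_finite_quotient hV R').symm)
  let g : V ≃ₗ[D] V := Φ.symm.trans
    (((LinearEquiv.refl D _).prodCongr ((LinearEquiv.refl D _).prodCongr e)).trans Φ')
  refine ⟨g, fun i => ⟨?_, ?_⟩⟩
  · rw [← hΦ]
    simp [g, hΦ']
  · have : ∀ x, α i x = α' i (g x) := by
      intro x
      obtain ⟨y, rfl⟩ := Φ.surjective x
      simp [g, hα, hα']
    ext x
    change α i (g⁻¹ x) = _
    rw [this]
    exact congrArg _ (g.apply_symm_apply x)

/-- All non-trivial transvections are conjugate. -/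
theorem exists_conj_tv (hV : ¬ Module.Finite D V) {φ ψ : Dual D V} {v w : V} (hφ : φ ≠ 0)
    (hv : v ≠ 0) (h : φ v = 0) (hψ : ψ ≠ 0) (hw : w ≠ 0) (h' : ψ w = 0) :
    ∃ k : V ≃ₗ[D] V, k * tv φ v * k⁻¹ = tv ψ w := by
  have dual : ∀ φ : Dual D V, φ ≠ 0 → ∃ x, φ x = 1 := by
    intro φ hφ
    obtain ⟨x, hx⟩ := DFunLike.ne_iff.1 hφ
    exact ⟨(φ x)⁻¹ • x, by rw [map_smul, smul_eq_mul]; exact inv_mul_cancel₀ hx⟩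
  obtain ⟨x, hx⟩ := dual φ hφ
  obtain ⟨y, hy⟩ := dual ψ hψ
  obtain ⟨g, hg⟩ := exists_map_frame hV (n := 1) (w := fun _ => v) (w' := fun _ => w)
    (α := fun _ => φ) (α' := fun _ => ψ) (u := fun _ => x) (u' := fun _ => y)
    (LinearIndependent.of_subsingleton 0 hv) (fun i j => by simp [Subsingleton.elim i j, hx])
    (fun _ _ => h) (LinearIndependent.of_subsingleton 0 hw)
    (fun i j => by simp [Subsingleton.elim i j, hy]) (fun _ _ => h')
  exact ⟨g, by rw [conj_tv, (hg 0).1, (hg 0).2]⟩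

/-- A product of two commuting transvections with independent centres and independent axes:
the linear forms `φ 0`, `φ 1` have dual vectors `u 0`, `u 1`. -/
def IsSquareZeroPair (φ : Fin 2 → Dual D V) (v : Fin 2 → V) : Prop :=
  LinearIndependent D v ∧ (∀ i j, φ i (v j) = 0) ∧
    ∃ u : Fin 2 → V, ∀ i j, φ i (u j) = if i = j then 1 else 0

theorem exists_conj_pair (hV : ¬ Module.Finite D V) {φ ψ : Fin 2 → Dual D V} {v w : Fin 2 → V}
    (h : IsSquareZeroPair φ v) (h' : IsSquareZeroPair ψ w) :
    ∃ k : V ≃ₗ[D] V, k * (tv (φ 0) (v 0) * tv (φ 1) (v 1)) * k⁻¹ =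
      tv (ψ 0) (w 0) * tv (ψ 1) (w 1) := by
  obtain ⟨hv, hφ, u, hu⟩ := h
  obtain ⟨hw, hψ, u', hu'⟩ := h'
  obtain ⟨g, hg⟩ := exists_map_frame hV hv hu hφ hw hu' hψ
  refine ⟨g, ?_⟩
  rw [← (hg 0).1, ← (hg 0).2, ← (hg 1).1, ← (hg 1).2, ← conj_tv, ← conj_tv]
  group

end Transvections

/-! ### A group-theoretic definition of transvections -/

section GroupPredicates

variable {G : Type*} [Group G]

/-- The elements that are, up to conjugation, a double commutator `⁅⁅y, g⁆, h⁆` for every `y ≠ 1`.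
In the projective group these contain all transvections and have finite rank. -/
def Core (x : G) : Prop := ∀ y : G, y ≠ 1 → ∃ k g h : G, x = ⁅⁅k * y * k⁻¹, g⁆, h⁆

/-- The elements that are, up to conjugation, a commutator `⁅y, h⁆` for every `y ≠ 1` in `S`. -/
def CommOf (S : G → Prop) (x : G) : Prop := ∀ y : G, S y → y ≠ 1 → ∃ k h : G, x = ⁅k * y * k⁻¹, h⁆

/-- The group-theoretic characterization of transvections. In the projective group the elements of
`CommOf (CommOf Core)` are products of two transvections, hence of rank at most two. The last
condition excludes rank two, since an automorphism of rank two commutes with some conjugate such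
that the product has rank four. -/
def IsTv (x : G) : Prop :=
  x ≠ 1 ∧ CommOf (CommOf Core) x ∧
    ∀ k : G, k * x * k⁻¹ * x = x * (k * x * k⁻¹) → CommOf (CommOf Core) (x * (k * x * k⁻¹))

theorem conj_commutator (k a b : G) : k * ⁅a, b⁆ * k⁻¹ = ⁅k * a * k⁻¹, k * b * k⁻¹⁆ := by
  simp only [commutatorElement_def]; group

theorem commutator_mul_of_commute {x a b : G} (h : ⁅x, b⁆ * a⁻¹ = a⁻¹ * ⁅x, b⁆) :
    ⁅x, a * b⁆ = ⁅x, a⁆ * ⁅x, b⁆ := by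
  have : ⁅x, a * b⁆ = x * a * x⁻¹ * (⁅x, b⁆ * a⁻¹) := by
    simp only [commutatorElement_def]; group
  rw [this, h, commutatorElement_def x a]
  group

end GroupPredicates

section CommutatorsWithTransvections

open Module Submodule

variable {D V : Type*} [DivisionRing D] [AddCommGroup V] [Module D V]

theorem commutator_tv (x : V ≃ₗ[D] V) {ψ : Dual D V} {w : V} (hψ : ψ w = 0) (hx : x w = w) :
    ⁅x, tv ψ w⁆ = tv (ψ ∘ₗ (x⁻¹ : V ≃ₗ[D] V).toLinearMap - ψ) w := by
  have hx' : x⁻¹ w = w := (LinearEquiv.symm_apply_eq x).2 hx.symm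
  rw [commutatorElement_def, conj_tv, hx, tv_inv hψ, tv_mul_left, sub_eq_add_neg]
  · change ψ (x⁻¹ w) = 0
    rw [hx', hψ]
  · simpa using hψ

/-- Every non-trivial transvection arises as a commutator with a given automorphism of finite
rank: the commutator of `x` with the transvection `(ψ, w)`, where `x w = w`, is the transvection
`(ψ ∘ x⁻¹ - ψ, w)`. -/
theorem exists_tv_eq_commutator (hV : ¬ Module.Finite D V) {x : V ≃ₗ[D] V} (hx : x ≠ 1)
    [Module.Finite D (res x)] {φ : Dual D V} {v : V} (hφ : φ ≠ 0) (hv : v ≠ 0) (h : φ v = 0) :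
    ∃ k l : V ≃ₗ[D] V, tv φ v = ⁅k * x * k⁻¹, l⁆ := by
  obtain ⟨u, hu⟩ : ∃ u, x⁻¹ u - u ≠ 0 := by
    by_contra! H
    apply hx
    rw [← inv_eq_one]
    ext u
    exact sub_eq_zero.1 (H u)
  obtain ⟨w, hw, hwu⟩ := exists_fixed_notMem hV x (span D {x⁻¹ u - u})
  have hw0 : w ≠ 0 := by rintro rfl; exact hwu (zero_mem _)
  have huw : x⁻¹ u - u ∉ span D {w} := by
    intro H
    obtain ⟨c, hc⟩ := mem_span_singleton.1 H
    have hc0 : c ≠ 0 := by rintro rfl; exact hu (by rw [← hc, zero_smul])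
    refine hwu (mem_span_singleton.2 ⟨c⁻¹, ?_⟩)
    rw [← hc, smul_smul, inv_mul_cancel₀ hc0, one_smul]
  obtain ⟨ψ, hψu, hψ⟩ := exists_le_ker_of_notMem huw
  have hψw : ψ w = 0 := hψ (mem_span_singleton_self w)
  have hc := commutator_tv x hψw hw
  set χ := ψ ∘ₗ (x⁻¹ : V ≃ₗ[D] V).toLinearMap - ψ
  have hχ : χ ≠ 0 := by
    intro H
    apply hψu
    have := LinearMap.congr_fun H u
    simpa [χ, sub_eq_zero] using this
  have hx' : x⁻¹ w = w := (LinearEquiv.symm_apply_eq x).2 hw.symm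
  have hχw : χ w = 0 := by
    change ψ (x⁻¹ w) - ψ w = 0
    rw [hx', sub_self]
  obtain ⟨k, hk⟩ := exists_conj_tv hV hχ hw0 hχw hφ hv h
  exact ⟨k, k * tv ψ w * k⁻¹, by rw [← hk, ← hc, conj_commutator]⟩

theorem exists_dual_family {ι : Type*} [Fintype ι] [DecidableEq ι] {b : ι → V}
    (hb : LinearIndependent D b) :
    ∃ ψ : ι → Dual D V, ∀ i j, ψ i (b j) = if i = j then 1 else 0 := by
  obtain ⟨l, hl⟩ := LinearMap.exists_leftInverse_of_injective (Fintype.linearCombination D b)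
    (LinearMap.ker_eq_bot.2 (linearIndependent_iff_injective_fintypeLinearCombination.1 hb))
  refine ⟨fun i => LinearMap.proj i ∘ₗ l, fun i j => ?_⟩
  have := LinearMap.congr_fun hl (Pi.single j 1)
  rw [LinearMap.comp_apply, Fintype.linearCombination_apply_single, one_smul] at this
  simp [this, Pi.single_apply]

/-- Products of two commuting transvections in general position are commutators with a given
automorphism of finite rank at least two. -/
theorem exists_pair_eq_commutator (hV : ¬ Module.Finite D V) {x : V ≃ₗ[D] V}
    [Module.Finite D (res x)] (hx : 2 ≤ finrank D (res x)) {φ : Fin 2 → Dual D V} {v : Fin 2 → V}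
    (h : IsSquareZeroPair φ v) :
    ∃ k l : V ≃ₗ[D] V, tv (φ 0) (v 0) * tv (φ 1) (v 1) = ⁅k * x * k⁻¹, l⁆ := by
  rw [← res_inv] at hx
  obtain ⟨a', ha'⟩ := exists_linearIndependent_of_le_finrank hx
  choose u hu using fun i => (a' i).2
  have ha : LinearIndependent D (fun i => x⁻¹ (u i) - u i) := by
    have := ha'.map' (res x⁻¹).subtype (ker_subtype _)
    rwa [show (res x⁻¹).subtype ∘ a' = fun i => x⁻¹ (u i) - u i from
      funext fun i => (hu i).symm] at this
  have fin_span : ∀ {n : ℕ} (b : Fin n → V), Module.Finite D (span D (Set.range b)) :=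
    fun b => Module.Finite.span_of_finite D (Set.finite_range b)
  have := fin_span fun i => x⁻¹ (u i) - u i
  obtain ⟨w₂, hw₂, hw₂'⟩ := exists_fixed_notMem hV x
    (span D (Set.range fun i => x⁻¹ (u i) - u i))
  have hb := linearIndependent_finCons.2 ⟨ha, hw₂'⟩
  have := fin_span (Fin.cons w₂ (fun i => x⁻¹ (u i) - u i) : Fin 3 → V)
  obtain ⟨w₁, hw₁, hw₁'⟩ := exists_fixed_notMem hV x (span D (Set.range
    (Fin.cons w₂ (fun i => x⁻¹ (u i) - u i) : Fin 3 → V)))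
  have hc := linearIndependent_finCons.2 ⟨hb, hw₁'⟩
  obtain ⟨ψ, hψ⟩ := exists_dual_family hc
  have fix : ∀ {w : V}, x w = w → x⁻¹ w = w := fun h => (LinearEquiv.symm_apply_eq x).2 h.symm
  have h20 : ψ 2 w₁ = 0 := hψ 2 0
  have h21 : ψ 2 w₂ = 0 := hψ 2 1
  have h30 : ψ 3 w₁ = 0 := hψ 3 0
  have h31 : ψ 3 w₂ = 0 := hψ 3 1
  let χ : Fin 4 → Dual D V := fun i => ψ i ∘ₗ (x⁻¹ : V ≃ₗ[D] V).toLinearMap - ψ i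
  have hχ : ∀ i y, χ i y = ψ i (x⁻¹ y - y) := fun i y => by rw [map_sub]; rfl
  have hχw : ∀ i w, x w = w → χ i w = 0 := fun i w h => by rw [hχ, fix h, sub_self, map_zero]
  have hsq : IsSquareZeroPair ![χ 2, χ 3] ![w₁, w₂] := by
    refine ⟨?_, ?_, u, ?_⟩
    · have := hc.comp ![0, 1] (by decide)
      convert this using 1
      ext i; fin_cases i <;> rfl
    · intro i j
      fin_cases i <;> fin_cases j <;> simp [hχw, hw₁, hw₂]
    · intro i j
      fin_cases i <;> fin_cases j <;> simp only [] <;> refine (hχ _ _).trans ?_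
      exacts [hψ 2 2, hψ 2 3, hψ 3 2, hψ 3 3]
  have e1 := commutator_tv x h20 hw₁
  have e2 := commutator_tv x h31 hw₂
  have hcomm : ⁅x, tv (ψ 2) w₁ * tv (ψ 3) w₂⁆ = tv (χ 2) w₁ * tv (χ 3) w₂ := by
    have e3 : tv (χ 3) w₂ * (tv (ψ 2) w₁)⁻¹ = (tv (ψ 2) w₁)⁻¹ * tv (χ 3) w₂ := by
      rw [tv_inv h20]
      exact tv_commute (hχw _ _ hw₂) (by simp [h20]) (hχw _ _ hw₁) (by simp [h21])
    rw [← show _ = tv (χ 3) w₂ from e2] at e3 ⊢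
    rw [← show _ = tv (χ 2) w₁ from e1]
    exact commutator_mul_of_commute e3
  obtain ⟨k, hk⟩ := exists_conj_pair hV hsq h
  refine ⟨k, k * (tv (ψ 2) w₁ * tv (ψ 3) w₂) * k⁻¹, ?_⟩
  rw [← hk, ← conj_commutator, hcomm]
  rfl

theorem exists_tv_eq_double_commutator (hV : ¬ Module.Finite D V) {t : V ≃ₗ[D] V}
    (ht : proj t ≠ 1) {φ : Dual D V} {v : V} (hφ : φ ≠ 0) (hv : v ≠ 0) (h : φ v = 0) :
    ∃ k g l : V ≃ₗ[D] V, tv φ v = ⁅⁅k * t * k⁻¹, g⁆, l⁆ := by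
  obtain ⟨u, hu⟩ := exists_notMem_span_of_proj_ne_one ht
  have hu0 : u ≠ 0 := by rintro rfl; simp at hu
  obtain ⟨ψ, hψu, hψ⟩ : ∃ ψ : Dual D V, ψ ≠ 0 ∧ ψ u = 0 := by
    obtain ⟨ψ, h1, h2⟩ := exists_le_ker_of_notMem hu
    exact ⟨ψ, fun h => h1 (by rw [h]; rfl), h2 (mem_span_singleton_self u)⟩
  have hx : ⁅t, tv ψ u⁆ ≠ 1 := by
    rw [Ne, commutatorElement_eq_one_iff_mul_comm]
    intro H
    obtain ⟨y, hy⟩ := DFunLike.ne_iff.1 hψu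
    have := LinearEquiv.congr_fun H y
    rw [LinearEquiv.mul_apply, LinearEquiv.mul_apply, tv_apply hψ, tv_apply hψ, map_add,
      map_smul, add_right_inj] at this
    apply hu
    rw [mem_span_singleton]
    exact ⟨(ψ y)⁻¹ * ψ (t y), by rw [mul_smul, ← this, smul_smul, inv_mul_cancel₀ hy, one_smul]⟩
  have hfin : Module.Finite D (res ⁅t, tv ψ u⁆) := by
    rw [commutatorElement_def]
    have := finite_res_tv ψ u
    have := finite_res_conj t (tv ψ u)
    have := finite_res_inv (tv ψ u)
    exact finite_res_mul _ _
  obtain ⟨k, l, hkl⟩ := exists_tv_eq_commutator hV hx hφ hv h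
  exact ⟨k, k * tv ψ u * k⁻¹, l, by rw [hkl, conj_commutator]⟩

end CommutatorsWithTransvections

/-! ### The group-theoretic definition is correct -/

section Characterization

open Module Submodule

variable {D V : Type*} [DivisionRing D] [AddCommGroup V] [Module D V]

theorem exists_dual_eq_one {φ : Dual D V} (hφ : φ ≠ 0) : ∃ x, φ x = 1 := by
  obtain ⟨x, hx⟩ := DFunLike.ne_iff.1 hφ
  exact ⟨(φ x)⁻¹ • x, by rw [map_smul, smul_eq_mul]; exact inv_mul_cancel₀ hx⟩

theorem exists_eq_mul_of_ker_le {φ ψ : Dual D V} (hφ : φ ≠ 0)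
    (h : LinearMap.ker φ ≤ LinearMap.ker ψ) : ∃ c, ∀ x, ψ x = φ x * c := by
  obtain ⟨y, hy⟩ := exists_dual_eq_one hφ
  refine ⟨ψ y, fun x => ?_⟩
  have : x - φ x • y ∈ LinearMap.ker φ := by simp [hy]
  have := h this
  rwa [LinearMap.mem_ker, map_sub, map_smul, sub_eq_zero, smul_eq_mul] at this

theorem ker_eq_of_ker_le {φ ψ : Dual D V} (hφ : φ ≠ 0) (hψ : ψ ≠ 0)
    (h : LinearMap.ker φ ≤ LinearMap.ker ψ) : LinearMap.ker φ = LinearMap.ker ψ := by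
  obtain ⟨c, hc⟩ := exists_eq_mul_of_ker_le hφ h
  refine le_antisymm h fun x hx => ?_
  have hc0 : c ≠ 0 := by
    rintro rfl
    exact hψ (LinearMap.ext fun x => by simp [hc])
  rw [LinearMap.mem_ker, hc] at hx
  exact (mul_eq_zero.1 hx).resolve_right hc0

theorem exists_eq_one_eq_zero {φ ψ : Dual D V} (hφ : φ ≠ 0) (hψ : ψ ≠ 0)
    (h : LinearMap.ker φ ≠ LinearMap.ker ψ) : ∃ x, φ x = 1 ∧ ψ x = 0 := by
  have : ¬ LinearMap.ker ψ ≤ LinearMap.ker φ := fun H => h (ker_eq_of_ker_le hψ hφ H).symm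
  obtain ⟨x, hx, hx'⟩ := SetLike.not_le_iff_exists.1 this
  rw [LinearMap.mem_ker] at hx hx'
  refine ⟨(φ x)⁻¹ • x, ?_, ?_⟩
  · rw [map_smul, smul_eq_mul, inv_mul_cancel₀ hx']
  · rw [map_smul, hx, smul_zero]

theorem exists_smul_eq_of_span_eq {v w : V} (h : span D {v} = span D {w}) : ∃ c : D, w = c • v := by
  have : w ∈ span D {v} := h ▸ mem_span_singleton_self w
  obtain ⟨c, hc⟩ := mem_span_singleton.1 this
  exact ⟨c, hc.symm⟩

theorem span_eq_of_eq_smul {v w : V} {c : D} (hw : w ≠ 0) (h : w = c • v) :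
    span D {v} = span D {w} := by
  rw [h]
  refine (span_singleton_smul_eq (IsUnit.mk0 c ?_) v).symm
  rintro rfl
  exact hw (by rw [h, zero_smul])

/-- Transvections with a common centre. -/
theorem tv_mul_of_span_eq {φ ψ : Dual D V} {v w : V} (hφ : φ v = 0) (hψ : ψ w = 0) (hw : w ≠ 0)
    (h : span D {v} = span D {w}) : ∃ χ : Dual D V, χ v = 0 ∧ tv φ v * tv ψ w = tv χ v := by
  obtain ⟨c, rfl⟩ := exists_smul_eq_of_span_eq h
  have hc : c ≠ 0 := by rintro rfl; exact hw (zero_smul _ _)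
  have hψv : ψ v = 0 := by
    rw [map_smul, smul_eq_mul] at hψ
    exact (mul_eq_zero.1 hψ).resolve_left hc
  have h1 : (LinearMap.toSpanSingleton D D c ∘ₗ ψ) v = 0 := by simp [hψv]
  refine ⟨φ + LinearMap.toSpanSingleton D D c ∘ₗ ψ, by simp [hφ, hψv], ?_⟩
  rw [← tv_mul_left hφ h1]
  congr 1
  ext x
  rw [tv_apply hψ, tv_apply h1]
  simp [mul_smul]

/-- Transvections with a common axis. -/
theorem tv_mul_of_ker_eq {φ ψ : Dual D V} {v w : V} (hφ : φ v = 0) (hψ : ψ w = 0) (hφ0 : φ ≠ 0)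
    (h : LinearMap.ker φ = LinearMap.ker ψ) :
    ∃ u : V, φ u = 0 ∧ tv φ v * tv ψ w = tv φ u := by
  obtain ⟨c, hc⟩ := exists_eq_mul_of_ker_le hφ0 h.le
  have hφw : φ w = 0 := by
    have : w ∈ LinearMap.ker φ := by rw [h]; exact hψ
    exact this
  have h1 : φ (c • w) = 0 := by simp [hφw]
  refine ⟨v + c • w, by simp [hφ, hφw], ?_⟩
  rw [← tv_mul_right hφ h1]
  congr 1
  ext x
  rw [tv_apply hψ, tv_apply h1, hc, mul_smul]

theorem two_le_finrank_res {φ ψ : Dual D V} {v w : V} (hφ : φ v = 0) (hψ : ψ w = 0) (hφ0 : φ ≠ 0)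
    (hψ0 : ψ ≠ 0) (hv : v ≠ 0) (hw : w ≠ 0) (h : span D {v} ≠ span D {w})
    (h' : LinearMap.ker φ ≠ LinearMap.ker ψ) : 2 ≤ finrank D (res (tv φ v * (tv ψ w)⁻¹)) := by
  have := finite_res_tv φ v
  have := finite_res_tv ψ w
  have := finite_res_inv (tv ψ w)
  have := finite_res_mul (tv φ v) (tv ψ w)⁻¹
  have key : ∀ x, φ x • v - ψ x • w ∈ res (tv φ v * (tv ψ w)⁻¹) := by
    intro x
    have := sub_mem_res (tv φ v * (tv ψ w)⁻¹) (tv ψ w x)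
    rw [← LinearEquiv.mul_apply, mul_assoc, inv_mul_cancel, mul_one, tv_apply hφ,
      tv_apply hψ] at this
    convert this using 1
    abel
  have hv' : v ∈ res (tv φ v * (tv ψ w)⁻¹) := by
    obtain ⟨x, hx, hx'⟩ := exists_eq_one_eq_zero hφ0 hψ0 h'
    simpa [hx, hx'] using key x
  have hw' : w ∈ res (tv φ v * (tv ψ w)⁻¹) := by
    obtain ⟨x, hx, hx'⟩ := exists_eq_one_eq_zero hψ0 hφ0 h'.symm
    simpa [hx, hx'] using key x
  have hli : LinearIndependent D ![v, w] := by
    rw [LinearIndependent.pair_iff' hv]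
    intro c hc
    exact h (span_eq_of_eq_smul hw hc.symm)
  have h1 : span D (Set.range ![v, w]) ≤ res (tv φ v * (tv ψ w)⁻¹) := by
    rw [span_le]
    rintro _ ⟨i, rfl⟩
    fin_cases i
    exacts [hv', hw']
  calc 2 = finrank D (span D (Set.range ![v, w])) := by rw [finrank_span_eq_card hli]; rfl
    _ ≤ _ := finrank_mono h1

theorem pairing_eq_zero_of_commute {φ ψ : Dual D V} {v w : V} (hφ : φ v = 0) (hψ : ψ w = 0)
    (hψ0 : ψ ≠ 0) (hv : v ≠ 0)
    (h : tv φ v * tv ψ w = tv ψ w * tv φ v) : φ w = 0 := by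
  by_contra hne
  obtain ⟨x, hx⟩ := exists_dual_eq_one hψ0
  have := LinearEquiv.congr_fun h x
  simp only [LinearEquiv.mul_apply, tv_apply hφ, tv_apply hψ, map_add, map_smul, hx, one_smul,
    smul_eq_mul, add_smul] at this
  have h2 : φ w • v = (φ x * ψ v) • w := by
    rw [← sub_eq_zero] at this ⊢
    rw [← this]; abel
  have h3 := congrArg φ h2
  rw [map_smul, map_smul, hφ, smul_zero, smul_eq_mul] at h3
  have h4 : φ x * ψ v = 0 := (mul_eq_zero.1 h3.symm).resolve_right hne
  rw [h4, zero_smul] at h2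
  exact (smul_ne_zero hne hv) h2

theorem nonempty_prod_linearEquiv {P Q : Type v} [AddCommGroup P] [Module D P] [AddCommGroup Q]
    [Module D Q] [Module.Finite D P] (hQ : ¬ Module.Finite D Q) :
    Nonempty ((P × Q) ≃ₗ[D] Q) := by
  have h1 : Cardinal.aleph0 ≤ Module.rank D Q := by
    rw [← not_lt, Module.rank_lt_aleph0_iff]; exact hQ
  have h2 : Module.rank D P < Cardinal.aleph0 := Module.rank_lt_aleph0_iff.2 inferInstance
  rw [Module.nonempty_linearEquiv_iff_rank_eq, rank_prod',
    Cardinal.add_eq_right h1 (h2.le.trans h1)]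

/-- An automorphism `z` of finite rank commutes with a conjugate of itself that acts on an
independent subspace, so that the rank of the product is twice the rank of `z`. -/
theorem exists_disjoint_conj (hV : ¬ Module.Finite D V) (z : V ≃ₗ[D] V)
    [Module.Finite D (res z)] :
    ∃ k : V ≃ₗ[D] V, k * z * k⁻¹ * z = z * (k * z * k⁻¹) ∧
      2 * finrank D (res z) ≤ finrank D (res (z * (k * z * k⁻¹))) := by
  set N := (z : V →ₗ[D] V) - LinearMap.id
  have hN : ∀ x, z x = x + N x := fun x => by simp [N]
  set F := LinearMap.ker N
  obtain ⟨C, hC⟩ := Submodule.exists_isCompl F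
  have : Module.Finite D (LinearMap.range N) := inferInstanceAs (Module.Finite D (res z))
  have : Module.Finite D C := Module.Finite.equiv
    ((quotientEquivOfIsCompl F C hC).symm.trans (LinearMap.quotKerEquivRange N)).symm
  set P := res z ⊔ C
  obtain ⟨Q, hQ1, hQ2⟩ := IsModularLattice.exists_disjoint_and_sup_eq (inf_le_right : P ⊓ F ≤ F)
  have hQF : Q ≤ F := hQ2 ▸ le_sup_right
  have hPQ : IsCompl P Q := by
    constructor
    · rw [disjoint_iff, ← le_bot_iff, ← hQ1.eq_bot]
      exact le_inf (le_inf inf_le_left (inf_le_right.trans hQF)) inf_le_right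
    · rw [codisjoint_iff, ← top_le_iff, ← hC.sup_eq_top, ← hQ2]
      exact sup_le (sup_le (inf_le_left.trans le_sup_left) le_sup_right)
        (le_sup_right.trans le_sup_left)
  have hQ : ¬ Module.Finite D Q := fun h => hV (Module.Finite.equiv (prodEquivOfIsCompl P Q hPQ))
  obtain ⟨e⟩ := nonempty_prod_linearEquiv (D := D) (P := P) hQ
  let E : (P × P × Q) ≃ₗ[D] V :=
    ((LinearEquiv.refl D P).prodCongr e).trans (prodEquivOfIsCompl P Q hPQ)
  have hE : ∀ p y, E (p, y) = p + e y := fun p y => by simp [E]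
  have hNP : ∀ x, N x ∈ P := fun x => (le_sup_left : res z ≤ P) (sub_mem_res z x)
  let A : V →ₗ[D] P := N.codRestrict P hNP
  have hNE : ∀ p y, N (E (p, y)) = A p := fun p y => by
    have : N (e y : V) = 0 := hQF (e y).2
    rw [hE, map_add, this, add_zero]; rfl
  have hzE : ∀ p y, z (E (p, y)) = E (p + A p, y) := fun p y => by
    rw [hN, hNE, hE, hE, coe_add]; abel
  let σ : (P × P × Q) ≃ₗ[D] (P × P × Q) :=
    { toFun := fun x => (x.2.1, x.1, x.2.2)
      invFun := fun x => (x.2.1, x.1, x.2.2)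
      map_add' := fun _ _ => rfl
      map_smul' := fun _ _ => rfl
      left_inv := fun _ => rfl
      right_inv := fun _ => rfl }
  let k : V ≃ₗ[D] V := (E.symm.trans σ).trans E
  have hk : ∀ p p' q, k (E (p, p', q)) = E (p', p, q) := fun p p' q => by simp [k, σ]
  have hk' : ∀ p p' q, k⁻¹ (E (p, p', q)) = E (p', p, q) := fun p p' q =>
    (LinearEquiv.symm_apply_eq k).2 (hk _ _ _).symm
  have hs : ∀ p p' q, (k * z * k⁻¹) (E (p, p', q)) = E (p, p' + A p', q) := fun p p' q => by
    rw [LinearEquiv.mul_apply, LinearEquiv.mul_apply, hk', hzE, hk]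
  refine ⟨k, ?_, ?_⟩
  · ext x
    obtain ⟨⟨p, p', q⟩, rfl⟩ := E.surjective x
    rw [LinearEquiv.mul_apply _ z, LinearEquiv.mul_apply z, hzE, hs, hs, hzE]
  · have := finite_res_conj k z
    have := finite_res_mul z (k * z * k⁻¹)
    let J : (res z × res z) →ₗ[D] V := E.toLinearMap ∘ₗ
      ((inclusion (le_sup_left : res z ≤ P)).prodMap
        (LinearMap.inl D P Q ∘ₗ inclusion (le_sup_left : res z ≤ P)))
    have hJ : Function.Injective J := by
      refine E.injective.comp ?_
      rintro ⟨⟨a, ha⟩, ⟨b, hb⟩⟩ ⟨⟨a', ha'⟩, ⟨b', hb'⟩⟩ h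
      simpa [Prod.ext_iff, Subtype.ext_iff] using h
    have hle : LinearMap.range J ≤ res (z * (k * z * k⁻¹)) := by
      rintro _ ⟨⟨⟨_, ⟨x, rfl⟩⟩, ⟨_, ⟨x', rfl⟩⟩⟩, rfl⟩
      obtain ⟨⟨p, y⟩, rfl⟩ := E.surjective x
      obtain ⟨⟨p', y'⟩, rfl⟩ := E.surjective x'
      have := sub_mem_res (z * (k * z * k⁻¹)) (E (p, p', 0))
      rw [LinearEquiv.mul_apply, hs, hzE, ← map_sub] at this
      convert this using 1
      change E _ = E _
      congr 1
      refine Prod.ext (Subtype.ext ?_) (Prod.ext (Subtype.ext ?_) ?_)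
      · exact (hNE p y).trans (by simp)
      · exact (hNE p' y').trans (by simp)
      · simp
    calc 2 * finrank D (res z) = finrank D (res z × res z) := by rw [finrank_prod, two_mul]
      _ = finrank D (LinearMap.range J) := (LinearMap.finrank_range_of_inj hJ).symm
      _ ≤ _ := finrank_mono hle

end Characterization

section Characterization

open Module Submodule

variable {D V : Type*} [DivisionRing D] [AddCommGroup V] [Module D V]

/-- The elements of the projective group induced by non-trivial transvections. -/
def IsProjTv (x : PGL D V) : Prop :=
  ∃ (φ : Dual D V) (v : V), φ ≠ 0 ∧ v ≠ 0 ∧ φ v = 0 ∧ x = proj (tv φ v)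

theorem proj_tv_ne_one {φ : Dual D V} {v : V} (hφ : φ ≠ 0) (hv : v ≠ 0) (h : φ v = 0) :
    proj (tv φ v) ≠ 1 := by
  intro H
  have := eq_one_of_proj_eq_one H hv (by rw [tv_apply h, h, zero_smul, add_zero])
  rw [tv_eq_one_iff h] at this
  exact this.elim hφ hv

theorem finrank_res_tv_le (φ : Dual D V) (v : V) : finrank D (res (tv φ v)) ≤ 1 :=
  (finrank_mono (res_tv_le φ v)).trans
    ((finrank_span_le_card ({v} : Set V)).trans (by simp))

theorem exists_tv_data (hV : ¬ Module.Finite D V) :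
    ∃ (φ : Dual D V) (v : V), φ ≠ 0 ∧ v ≠ 0 ∧ φ v = 0 := by
  obtain ⟨v, hv⟩ := exists_notMem_of_finite hV (⊥ : Submodule D V)
  obtain ⟨w, hw⟩ := exists_notMem_of_finite hV (span D {v})
  obtain ⟨φ, h1, h2⟩ := exists_le_ker_of_notMem hw
  exact ⟨φ, v, fun h => h1 (by rw [h]; rfl), hv, h2 (mem_span_singleton_self v)⟩

theorem proj_commutator (a b : V ≃ₗ[D] V) : proj ⁅a, b⁆ = ⁅proj a, proj b⁆ :=
  map_commutatorElement _ _ _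

/-- The first commutator with a suitable transvection makes the rank finite, the second one produces
a given transvection. -/
theorem IsProjTv.core (hV : ¬ Module.Finite D V) {x : PGL D V} (hx : IsProjTv x) : Core x := by
  obtain ⟨φ, v, hφ, hv, h, rfl⟩ := hx
  intro y hy
  obtain ⟨t, rfl⟩ := proj_surjective y
  obtain ⟨k, g, l, hk⟩ := exists_tv_eq_double_commutator hV hy hφ hv h
  exact ⟨proj k, proj g, proj l, by simp only [hk, proj_commutator, map_mul, map_inv]⟩

theorem Core.exists_finite_res (hV : ¬ Module.Finite D V) {x : PGL D V} (hx : Core x) :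
    ∃ z : V ≃ₗ[D] V, x = proj z ∧ Module.Finite D (res z) := by
  obtain ⟨φ, v, hφ, hv, h⟩ := exists_tv_data (D := D) hV
  obtain ⟨k, g, l, rfl⟩ := hx _ (proj_tv_ne_one hφ hv h)
  obtain ⟨k, rfl⟩ := proj_surjective k
  obtain ⟨g, rfl⟩ := proj_surjective g
  obtain ⟨l, rfl⟩ := proj_surjective l
  have fin_comm : ∀ a b : V ≃ₗ[D] V, Module.Finite D (res a) → Module.Finite D (res ⁅a, b⁆) := by
    intro a b ha
    rw [commutatorElement_def, mul_assoc, mul_assoc, ← mul_assoc b]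
    have := finite_res_inv a
    have := finite_res_conj b a⁻¹
    exact finite_res_mul _ _
  have := finite_res_tv φ v
  refine ⟨⁅⁅k * tv φ v * k⁻¹, g⁆, l⁆, ?_, fin_comm _ _ (fin_comm _ _ (finite_res_conj _ _))⟩
  simp only [proj_commutator, map_mul, map_inv]

theorem IsProjTv.commOf (hV : ¬ Module.Finite D V) {S : PGL D V → Prop}
    (hS : ∀ y, S y → ∃ z : V ≃ₗ[D] V, y = proj z ∧ Module.Finite D (res z))
    {x : PGL D V} (hx : IsProjTv x) : CommOf S x := by
  obtain ⟨φ, v, hφ, hv, h, rfl⟩ := hx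
  intro y hy hy1
  obtain ⟨z, rfl, _⟩ := hS y hy
  obtain ⟨k, l, hk⟩ := exists_tv_eq_commutator hV (x := z) (by rintro rfl; exact hy1 (map_one _))
    hφ hv h
  exact ⟨proj k, proj l, by simp only [hk, proj_commutator, map_mul, map_inv]⟩

/-- If `S` contains all transvections then the elements of `CommOf S` are products of two
transvections. -/
theorem CommOf.exists_tv_mul (hV : ¬ Module.Finite D V) {S : PGL D V → Prop}
    (hS : ∀ y, IsProjTv y → S y) {x : PGL D V} (hx : CommOf S x) :
    ∃ (φ ψ : Dual D V) (v w : V), φ ≠ 0 ∧ v ≠ 0 ∧ φ v = 0 ∧ ψ ≠ 0 ∧ w ≠ 0 ∧ ψ w = 0 ∧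
      x = proj (tv φ v * (tv ψ w)⁻¹) := by
  obtain ⟨φ, v, hφ, hv, h⟩ := exists_tv_data (D := D) hV
  obtain ⟨k, l, rfl⟩ := hx _ (hS _ ⟨φ, v, hφ, hv, h, rfl⟩) (proj_tv_ne_one hφ hv h)
  obtain ⟨k, rfl⟩ := proj_surjective k
  obtain ⟨l, rfl⟩ := proj_surjective l
  have comp_ne : ∀ (g : V ≃ₗ[D] V), φ ∘ₗ (g⁻¹ : V ≃ₗ[D] V).toLinearMap ≠ 0 := by
    intro g H
    apply hφ
    ext x
    simpa using LinearMap.congr_fun H (g x)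
  have comp_eq : ∀ (g : V ≃ₗ[D] V), (φ ∘ₗ (g⁻¹ : V ≃ₗ[D] V).toLinearMap) (g v) = 0 := by
    intro g; simpa using h
  have e : k * tv φ v * k⁻¹ * (l * k * tv φ v * (l * k)⁻¹)⁻¹ = ⁅k * tv φ v * k⁻¹, l⁆ := by
    simp only [commutatorElement_def]; group
  refine ⟨_, _, _, _, comp_ne k, (k.map_ne_zero_iff).2 hv, comp_eq k, comp_ne (l * k),
    ((l * k).map_ne_zero_iff).2 hv, comp_eq (l * k), ?_⟩
  rw [← conj_tv, ← conj_tv, e]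
  simp only [proj_commutator, map_mul, map_inv]

/-- A product of two transvections is a transvection if they have a common centre or axis, and has
rank two otherwise. -/
theorem isProjTv_or_of_commOf (hV : ¬ Module.Finite D V) {S : PGL D V → Prop}
    (hS : ∀ y, IsProjTv y → S y) {x : PGL D V} (hx : CommOf S x) (hx1 : x ≠ 1) :
    IsProjTv x ∨ ∃ z : V ≃ₗ[D] V, x = proj z ∧ Module.Finite D (res z) ∧
      2 ≤ finrank D (res z) ∧ finrank D (res z) ≤ 2 := by
  obtain ⟨φ, ψ, v, w, hφ, hv, h, hψ, hw, h', rfl⟩ := hx.exists_tv_mul hV hS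
  have hinv := tv_inv h'
  have h'' : (-ψ) w = 0 := by simpa using h'
  by_cases hs : span D {v} = span D {w}
  · left
    obtain ⟨χ, hχ, e⟩ := tv_mul_of_span_eq h h'' hw hs
    rw [hinv, e] at hx1 ⊢
    refine ⟨χ, v, ?_, hv, hχ, rfl⟩
    rintro rfl
    exact hx1 (by rw [(tv_eq_one_iff hχ).2 (Or.inl rfl), map_one])
  by_cases hk : LinearMap.ker φ = LinearMap.ker ψ
  · left
    obtain ⟨u, hu, e⟩ := tv_mul_of_ker_eq h h'' hφ (hk.trans (LinearMap.ker_neg ψ).symm)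
    rw [hinv, e] at hx1 ⊢
    refine ⟨φ, u, hφ, ?_, hu, rfl⟩
    rintro rfl
    exact hx1 (by rw [(tv_eq_one_iff hu).2 (Or.inr rfl), map_one])
  · right
    have := finite_res_tv φ v
    have := finite_res_tv ψ w
    have := finite_res_inv (tv ψ w)
    refine ⟨_, rfl, finite_res_mul _ _, two_le_finrank_res h h' hφ hψ hv hw hs hk, ?_⟩
    refine (finrank_mono (res_mul_le _ _)).trans ?_
    rw [res_inv]
    refine (finrank_add_le_finrank_add_finrank _ _).trans ?_
    exact add_le_add (finrank_res_tv_le φ v) (finrank_res_tv_le ψ w)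

/-- An element of `CommOf Core` is a transvection or has rank two; in both cases some commutator
with it is conjugate to the given product. -/
theorem commOf_pair (hV : ¬ Module.Finite D V) {φ : Fin 2 → Dual D V} {v : Fin 2 → V}
    (h : IsSquareZeroPair φ v) :
    CommOf (CommOf Core) (proj (tv (φ 0) (v 0) * tv (φ 1) (v 1))) := by
  intro y hy hy1
  obtain ⟨χ, u, hχ, hu, hχu, rfl⟩ | ⟨z, rfl, _, hz, -⟩ :=
    isProjTv_or_of_commOf hV (fun y hy => IsProjTv.core hV hy) hy hy1
  · obtain ⟨hv, hφ, a, ha⟩ := h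
    have hφ0 : ∀ i, φ i ≠ 0 := fun i H => by simpa [H] using ha i i
    obtain ⟨k, hk⟩ := exists_conj_tv hV hχ hu hχu (hφ0 0) (hv.ne_zero 0) (hφ 0 0)
    obtain ⟨l, hl⟩ := exists_conj_tv hV (hφ0 0) (hv.ne_zero 0) (hφ 0 0) (neg_ne_zero.2 (hφ0 1))
      (hv.ne_zero 1) (by simpa using hφ 1 1)
    refine ⟨proj k, proj l, ?_⟩
    rw [← map_inv, ← map_mul, ← map_mul, hk, ← proj_commutator]
    congr 1
    rw [← tv_inv (hφ 1 1)] at hl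
    rw [← inv_inv (tv (φ 1) (v 1)), ← hl, commutatorElement_def]
    group
  · obtain ⟨k, l, hk⟩ := exists_pair_eq_commutator hV hz h
    exact ⟨proj k, proj l, by simp only [hk, proj_commutator, map_mul, map_inv]⟩

theorem commOf_one {G : Type*} [Group G] {S : G → Prop} : CommOf S (1 : G) :=
  fun y _ _ => ⟨1, 1, by simp⟩

theorem CommOf.exists_finite_res (hV : ¬ Module.Finite D V) {x : PGL D V} (hx : CommOf Core x) :
    ∃ z : V ≃ₗ[D] V, x = proj z ∧ Module.Finite D (res z) := by
  obtain ⟨φ, ψ, v, w, -, -, -, -, -, -, rfl⟩ := hx.exists_tv_mul hV fun y hy => IsProjTv.core hV hy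
  have := finite_res_tv φ v
  have := finite_res_tv ψ w
  have := finite_res_inv (tv ψ w)
  exact ⟨_, rfl, finite_res_mul _ _⟩

/-- The product of two commuting transvections is a transvection or is given by a square-zero
pair. -/
theorem commOf_tv_mul (hV : ¬ Module.Finite D V) {φ ψ : Dual D V} {v w : V} (hφ : φ ≠ 0)
    (hv : v ≠ 0) (h : φ v = 0) (hψ : ψ ≠ 0) (hw : w ≠ 0) (h' : ψ w = 0)
    (hc : tv φ v * tv ψ w = tv ψ w * tv φ v) :
    CommOf (CommOf Core) (proj (tv φ v * tv ψ w)) := by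
  have htv : ∀ {φ : Dual D V} {v : V}, φ v = 0 → CommOf (CommOf Core) (proj (tv φ v)) := by
    intro φ v h
    by_cases h1 : tv φ v = 1
    · rw [h1, map_one]; exact commOf_one
    · rw [tv_eq_one_iff h] at h1
      push Not at h1
      exact IsProjTv.commOf hV (fun y hy => hy.exists_finite_res hV) ⟨φ, v, h1.1, h1.2, h, rfl⟩
  by_cases hs : span D {v} = span D {w}
  · obtain ⟨χ, hχ, e⟩ := tv_mul_of_span_eq h h' hw hs
    rw [e]; exact htv hχ
  by_cases hk : LinearMap.ker φ = LinearMap.ker ψ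
  · obtain ⟨u, hu, e⟩ := tv_mul_of_ker_eq h h' hφ hk
    rw [e]; exact htv hu
  have h1 := pairing_eq_zero_of_commute h h' hψ hv hc
  have h2 := pairing_eq_zero_of_commute h' h hφ hw hc.symm
  obtain ⟨a, ha, ha'⟩ := exists_eq_one_eq_zero hφ hψ hk
  obtain ⟨b, hb, hb'⟩ := exists_eq_one_eq_zero hψ hφ (Ne.symm hk)
  refine commOf_pair hV (φ := ![φ, ψ]) (v := ![v, w]) ⟨?_, ?_, ![a, b], ?_⟩
  · rw [LinearIndependent.pair_iff' hv]
    intro c hc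
    exact hs (span_eq_of_eq_smul hw hc.symm)
  · intro i j
    fin_cases i <;> fin_cases j <;> simp [h, h', h1, h2]
  · intro i j
    fin_cases i <;> fin_cases j <;> simp [ha, ha', hb, hb']

/-- In the projective group of an infinite-dimensional space `IsTv` defines the transvections. -/
theorem isTv_iff (hV : ¬ Module.Finite D V) (x : PGL D V) : IsTv x ↔ IsProjTv x := by
  constructor
  · rintro ⟨hx1, hx, hk⟩
    have hS : ∀ y : PGL D V, IsProjTv y → CommOf Core y := fun y hy =>
      IsProjTv.commOf hV (fun y hy => hy.exists_finite_res hV) hy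
    obtain h | ⟨z, rfl, _, hz, -⟩ := isProjTv_or_of_commOf hV hS hx hx1
    · exact h
    exfalso
    -- a product of rank four is not a product of two transvections
    obtain ⟨k, hc, hr⟩ := exists_disjoint_conj hV z
    have hk' := hk (proj k) (by simp only [← map_inv, ← map_mul, hc])
    rw [← map_inv, ← map_mul, ← map_mul, ← map_mul] at hk'
    have hne : proj (z * (k * z * k⁻¹)) ≠ 1 := by
      intro H
      have := finite_res_conj k z
      have := finite_res_mul z (k * z * k⁻¹)
      obtain ⟨w, hw, hw', -⟩ := exists_common_fixed hV (z * (k * z * k⁻¹)) z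
      have hbot : res (z * (k * z * k⁻¹)) = ⊥ := by
        rw [eq_one_of_proj_eq_one H hw hw', ← le_bot_iff, res_le_iff]
        intro x; simp
      rw [hbot, finrank_bot] at hr
      omega
    have := finite_res_conj k z
    have := finite_res_mul z (k * z * k⁻¹)
    have key : ∀ y : V ≃ₗ[D] V, Module.Finite D (res y) →
        proj (z * (k * z * k⁻¹)) = proj y → 4 ≤ finrank D (res y) := by
      intro y _ hy
      obtain ⟨w, hw, h1, h2⟩ := exists_common_fixed hV (z * (k * z * k⁻¹)) y
      rw [← eq_of_proj_eq hy hw h1 h2]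
      omega
    obtain ⟨φ, v, -, -, -, h⟩ | ⟨y, h, hfin, -, hy⟩ := isProjTv_or_of_commOf hV hS hk' hne
    · have h1 := key _ (finite_res_tv φ v) h
      have h2 : finrank D (res (tv φ v)) ≤ 1 := finrank_res_tv_le φ v
      omega
    · have := key y hfin h
      omega
  · rintro hx
    refine ⟨?_, IsProjTv.commOf hV (fun y hy => hy.exists_finite_res hV) hx, ?_⟩
    · obtain ⟨φ, v, hφ, hv, h, rfl⟩ := hx
      exact proj_tv_ne_one hφ hv h
    · obtain ⟨φ, v, hφ, hv, h, rfl⟩ := hx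
      intro k hk
      obtain ⟨k, rfl⟩ := proj_surjective k
      have h0 : φ ∘ₗ (k⁻¹ : V ≃ₗ[D] V).toLinearMap ≠ 0 := by
        intro H
        apply hφ
        ext x
        simpa using LinearMap.congr_fun H (k x)
      have h1 : (φ ∘ₗ (k⁻¹ : V ≃ₗ[D] V).toLinearMap) (k v) = 0 := by simpa using h
      have h2 : k v ≠ 0 := k.map_ne_zero_iff.2 hv
      simp only [← map_inv, ← map_mul, conj_tv] at hk ⊢
      refine commOf_tv_mul hV hφ hv h h0 h2 h1 ?_
      have := finite_res_tv φ v
      have := finite_res_tv (φ ∘ₗ (k⁻¹ : V ≃ₗ[D] V).toLinearMap) (k v)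
      obtain ⟨w, hw, h3, h4⟩ := exists_common_fixed hV (tv φ v)
        (tv (φ ∘ₗ (k⁻¹ : V ≃ₗ[D] V).toLinearMap) (k v))
      refine (eq_of_proj_eq hk hw ?_ ?_).symm
      · rw [LinearEquiv.mul_apply, h3, h4]
      · rw [LinearEquiv.mul_apply, h4, h3]

end Characterization

/-! ### Centres, axes and incidence -/

section IncidencePredicates

variable {G : Type*} [Group G]

/-- Two transvections have the same centre or the same axis. -/
def Adj (x y : G) : Prop := x = y ∨ IsTv (x * y⁻¹)

/-- Two transvections have the same centre and the same axis. -/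
def SameFlag (x y : G) : Prop := ∀ z : G, IsTv z → (Adj z x ↔ Adj z y)

/-- The pair of transvections `x`, `y` has either a common centre or a common axis, but not both.
Such a pair represents this common centre or axis. -/
def IsCode (x y : G) : Prop := IsTv x ∧ IsTv y ∧ Adj x y ∧ ¬ SameFlag x y

/-- The transvection `z` has the centre or axis represented by the pair `x`, `y`. -/
def Mem (x y z : G) : Prop := IsTv z ∧ Adj z x ∧ Adj z y

/-- The pairs `c₁`, `c₂` and `x`, `y` either both represent centres or both represent axes. Indeed
any two centres lie on a common axis, any two axes pass through a common centre, and the classes of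
transvections with a given centre are equal or disjoint, as are those with a given axis. A class of
the one kind has adjacent members with a class of the other kind only if the centre lies on the
axis, and then the two classes overlap without being equal. -/
def SameType (c₁ c₂ x y : G) : Prop :=
  (∃ a b, Mem c₁ c₂ a ∧ Mem x y b ∧ Adj a b) ∧
    ((∀ a, ¬ (Mem c₁ c₂ a ∧ Mem x y a)) ∨ ∀ a, (Mem c₁ c₂ a ↔ Mem x y a))

/-- Equality of the centres of two transvections if the pair `c₁`, `c₂` represents a centre, and
equality of their axes otherwise. -/
def PartEq (c₁ c₂ x y : G) : Prop := Adj x y ∧ (SameFlag x y ∨ SameType c₁ c₂ x y)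

/-- Equality of the axes of two transvections if the pair `c₁`, `c₂` represents a centre, and
equality of their centres otherwise. -/
def CoPartEq (c₁ c₂ x y : G) : Prop := Adj x y ∧ (SameFlag x y ∨ ¬ SameType c₁ c₂ x y)

end IncidencePredicates

section Incidence

open Module Submodule

variable {D V : Type*} [DivisionRing D] [AddCommGroup V] [Module D V]

/-- The element `x` of the projective group is a transvection with centre `p` and axis `H`. -/
def HasFlag (p H : Submodule D V) (x : PGL D V) : Prop :=
  ∃ (φ : Dual D V) (v : V), φ ≠ 0 ∧ v ≠ 0 ∧ φ v = 0 ∧ x = proj (tv φ v) ∧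
    span D {v} = p ∧ LinearMap.ker φ = H

theorem isCoatom_ker {φ : Dual D V} (hφ : φ ≠ 0) : IsCoatom (LinearMap.ker φ) := by
  refine ⟨fun h => hφ (LinearMap.ker_eq_top.1 h), fun F hF => ?_⟩
  obtain ⟨x, hx, hx'⟩ := SetLike.exists_of_lt hF
  rw [LinearMap.mem_ker] at hx'
  rw [eq_top_iff]
  intro y _
  have h1 : y - (φ y * (φ x)⁻¹) • x ∈ LinearMap.ker φ := by
    rw [LinearMap.mem_ker, map_sub, map_smul, smul_eq_mul, mul_assoc, inv_mul_cancel₀ hx', mul_one,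
      sub_self]
  have := F.add_mem (hF.le h1) (F.smul_mem (φ y * (φ x)⁻¹) hx)
  rwa [sub_add_cancel] at this

theorem exists_ker_eq_of_isCoatom {H : Submodule D V} (hH : IsCoatom H) :
    ∃ φ : Dual D V, φ ≠ 0 ∧ LinearMap.ker φ = H := by
  obtain ⟨φ, hφ, h⟩ := exists_le_ker_of_lt_top H hH.lt_top
  refine ⟨φ, hφ, ?_⟩
  rcases hH.le_iff.1 h with h | h
  · exact absurd (LinearMap.ker_eq_top.1 h) hφ
  · exact h

theorem exists_span_eq_of_isAtom {p : Submodule D V} (hp : IsAtom p) :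
    ∃ v : V, v ≠ 0 ∧ span D {v} = p := by
  obtain ⟨v, hv, hv0⟩ := p.ne_bot_iff.1 hp.1
  refine ⟨v, hv0, ?_⟩
  rcases hp.le_iff.1 ((span_singleton_le_iff_mem v p).2 hv) with h | h
  · exact absurd (span_singleton_eq_bot.1 h) hv0
  · exact h

theorem HasFlag.isAtom {p H : Submodule D V} {x : PGL D V} (h : HasFlag p H x) : IsAtom p := by
  obtain ⟨φ, v, hφ, hv, h, rfl, rfl, rfl⟩ := h
  exact nonzero_span_atom v hv

theorem HasFlag.isCoatom {p H : Submodule D V} {x : PGL D V} (h : HasFlag p H x) :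
    IsCoatom H := by
  obtain ⟨φ, v, hφ, hv, h, rfl, rfl, rfl⟩ := h
  exact isCoatom_ker hφ

theorem HasFlag.le {p H : Submodule D V} {x : PGL D V} (h : HasFlag p H x) : p ≤ H := by
  obtain ⟨φ, v, hφ, hv, h, rfl, rfl, rfl⟩ := h
  rwa [span_singleton_le_iff_mem]

theorem exists_hasFlag {p H : Submodule D V} (hp : IsAtom p) (hH : IsCoatom H) (h : p ≤ H) :
    ∃ x, HasFlag p H x := by
  obtain ⟨v, hv, rfl⟩ := exists_span_eq_of_isAtom hp
  obtain ⟨φ, hφ, rfl⟩ := exists_ker_eq_of_isCoatom hH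
  exact ⟨_, φ, v, hφ, hv, (span_singleton_le_iff_mem v _).1 h, rfl, rfl, rfl⟩

theorem HasFlag.conj {p H : Submodule D V} {x : PGL D V} (h : HasFlag p H x) (g : PGL D V) :
    HasFlag (g.1 p) (g.1 H) (g * x * g⁻¹) := by
  obtain ⟨φ, v, hφ, hv, h, rfl, rfl, rfl⟩ := h
  obtain ⟨g, rfl⟩ := proj_surjective g
  refine ⟨φ ∘ₗ (g⁻¹ : V ≃ₗ[D] V).toLinearMap, g v, ?_, g.map_ne_zero_iff.2 hv, by simpa using h,
    ?_, ?_, ?_⟩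
  · intro H
    apply hφ
    ext x
    simpa using LinearMap.congr_fun H (g x)
  · rw [← conj_tv]; simp
  · rw [proj_apply, map_span, Set.image_singleton]; rfl
  · rw [proj_apply]
    ext y
    constructor
    · intro hy
      exact ⟨g⁻¹ y, hy, g.apply_symm_apply y⟩
    · rintro ⟨z, hz, rfl⟩
      simpa using hz

theorem isTv_iff_exists_hasFlag (hV : ¬ Module.Finite D V) (x : PGL D V) :
    IsTv x ↔ ∃ p H, HasFlag p H x := by
  rw [isTv_iff hV]
  constructor
  · rintro ⟨φ, v, hφ, hv, h, e⟩
    exact ⟨_, _, φ, v, hφ, hv, h, e, rfl, rfl⟩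
  · rintro ⟨_, _, φ, v, hφ, hv, h, e, -, -⟩
    exact ⟨φ, v, hφ, hv, h, e⟩

theorem adj_iff (hV : ¬ Module.Finite D V) {p H p' H' : Submodule D V} {x y : PGL D V}
    (hx : HasFlag p H x) (hy : HasFlag p' H' y) : Adj x y ↔ p = p' ∨ H = H' := by
  obtain ⟨φ, v, hφ, hv, h, rfl, rfl, rfl⟩ := hx
  obtain ⟨ψ, w, hψ, hw, h', rfl, rfl, rfl⟩ := hy
  have := finite_res_tv φ v
  have := finite_res_tv ψ w
  have := finite_res_inv (tv ψ w)
  have hinv := tv_inv h'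
  have h'' : (-ψ) w = 0 := by simpa using h'
  rw [Adj, isTv_iff hV, ← map_inv, ← map_mul]
  constructor
  · intro H
    by_contra! hne
    have h2 := two_le_finrank_res h h' hφ hψ hv hw hne.1 hne.2
    have := finite_res_mul (tv φ v) (tv ψ w)⁻¹
    have : ∃ χ u, proj (tv φ v * (tv ψ w)⁻¹) = proj (tv χ u) := by
      rcases H with H | ⟨χ, u, -, -, -, H⟩
      · refine ⟨0, 0, ?_⟩
        rw [(tv_eq_one_iff (by simp)).2 (Or.inl rfl), map_mul, map_inv, H, mul_inv_cancel, map_one]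
      · exact ⟨χ, u, H⟩
    obtain ⟨χ, u, hχ⟩ := this
    have := finite_res_tv χ u
    obtain ⟨a, ha, h3, h4⟩ := exists_common_fixed hV (tv φ v * (tv ψ w)⁻¹) (tv χ u)
    rw [eq_of_proj_eq hχ ha h3 h4] at h2
    have := finrank_res_tv_le χ u
    omega
  · intro H
    have : ∃ χ u, χ u = 0 ∧ tv φ v * (tv ψ w)⁻¹ = tv χ u := by
      rw [hinv]
      rcases H with H | H
      · obtain ⟨χ, hχ⟩ := tv_mul_of_span_eq h h'' hw H
        exact ⟨χ, v, hχ⟩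
      · obtain ⟨u, hu⟩ := tv_mul_of_ker_eq h h'' hφ (H.trans (LinearMap.ker_neg ψ).symm)
        exact ⟨φ, u, hu⟩
    obtain ⟨χ, u, hχ, e⟩ := this
    rw [e]
    by_cases h0 : χ = 0 ∨ u = 0
    · left
      rw [(tv_eq_one_iff hχ).2 h0, mul_inv_eq_one] at e
      rw [e]
    · push Not at h0
      exact Or.inr ⟨χ, u, h0.1, h0.2, hχ, rfl⟩

theorem exists_isCoatom_ge (hV : ¬ Module.Finite D V) {p q : Submodule D V} (hp : IsAtom p)
    (hq : IsAtom q) (K : Submodule D V) : ∃ H, IsCoatom H ∧ H ≠ K ∧ p ≤ H ∧ q ≤ H := by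
  obtain ⟨v, hv, rfl⟩ := exists_span_eq_of_isAtom hp
  obtain ⟨w, hw, rfl⟩ := exists_span_eq_of_isAtom hq
  obtain ⟨a, ha⟩ := exists_notMem_of_finite hV (span D {v} ⊔ span D {w})
  obtain ⟨b, hb⟩ := exists_notMem_of_finite hV
    (span D {v} ⊔ span D {w} ⊔ span D {a})
  have hab : a ∉ span D {v} ⊔ span D {w} ⊔ span D {b} := by
    intro H
    obtain ⟨y, hy, z, hz, hyz⟩ := mem_sup.1 H
    obtain ⟨c, rfl⟩ := mem_span_singleton.1 hz
    by_cases hc : c = 0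
    · rw [hc, zero_smul, add_zero] at hyz
      exact ha (hyz ▸ hy)
    · apply hb
      rw [show b = c⁻¹ • (a - y) by
        rw [← hyz, add_sub_cancel_left, smul_smul, inv_mul_cancel₀ hc, one_smul]]
      exact smul_mem _ _ (sub_mem (mem_sup_right (mem_span_singleton_self a)) (mem_sup_left hy))
  obtain ⟨φ, hφ, hφ'⟩ := exists_le_ker_of_notMem hab
  obtain ⟨ψ, hψ, hψ'⟩ := exists_le_ker_of_notMem hb
  have hne : LinearMap.ker φ ≠ LinearMap.ker ψ := by
    intro H
    apply hφ
    change a ∈ LinearMap.ker φ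
    rw [H]
    exact hψ' (mem_sup_right (mem_span_singleton_self a))
  have h1 : IsCoatom (LinearMap.ker φ) := isCoatom_ker fun h => hφ (by rw [h]; rfl)
  have h2 : IsCoatom (LinearMap.ker ψ) := isCoatom_ker fun h => hψ (by rw [h]; rfl)
  by_cases h : LinearMap.ker φ = K
  · exact ⟨_, h2, fun h' => hne (h.trans h'.symm),
      (le_sup_left.trans le_sup_left).trans hψ', (le_sup_right.trans le_sup_left).trans hψ'⟩
  · exact ⟨_, h1, h, (le_sup_left.trans le_sup_left).trans hφ',
      (le_sup_right.trans le_sup_left).trans hφ'⟩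

theorem exists_isAtom_le (hV : ¬ Module.Finite D V) {H K : Submodule D V} (hH : IsCoatom H)
    (hK : IsCoatom K) (q : Submodule D V) : ∃ p, IsAtom p ∧ p ≠ q ∧ p ≤ H ∧ p ≤ K := by
  obtain ⟨φ, hφ, rfl⟩ := exists_ker_eq_of_isCoatom hH
  obtain ⟨ψ, hψ, rfl⟩ := exists_ker_eq_of_isCoatom hK
  obtain ⟨a, ha, ha'⟩ := exists_mem_ker_notMem hV (φ.prod ψ) ⊥
  obtain ⟨b, hb, hb'⟩ := exists_mem_ker_notMem hV (φ.prod ψ) (span D {a})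
  have hb0 : b ≠ 0 := by rintro rfl; exact hb' (zero_mem _)
  have h1 := Prod.ext_iff.1 ha
  have h2 := Prod.ext_iff.1 hb
  by_cases h : span D {a} = q
  · exact ⟨span D {b}, nonzero_span_atom b hb0,
      fun h' => hb' (h.trans h'.symm ▸ mem_span_singleton_self b),
      (span_singleton_le_iff_mem _ _).2 h2.1, (span_singleton_le_iff_mem _ _).2 h2.2⟩
  · exact ⟨span D {a}, nonzero_span_atom a ha', h, (span_singleton_le_iff_mem _ _).2 h1.1,
      (span_singleton_le_iff_mem _ _).2 h1.2⟩

theorem sameFlag_iff (hV : ¬ Module.Finite D V) {p H p' H' : Submodule D V} {x y : PGL D V}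
    (hx : HasFlag p H x) (hy : HasFlag p' H' y) : SameFlag x y ↔ p = p' ∧ H = H' := by
  constructor
  · intro h
    have h1 : p = p' ∨ H = H' := (adj_iff hV hx hy).1
      ((h x ((isTv_iff_exists_hasFlag hV x).2 ⟨_, _, hx⟩)).1 (Or.inl rfl))
    by_contra! hne
    by_cases hp : p = p'
    · obtain ⟨q, hq, hqp, hqH, -⟩ := exists_isAtom_le hV hx.isCoatom hx.isCoatom p
      obtain ⟨z, hz⟩ := exists_hasFlag hq hx.isCoatom hqH
      rcases (adj_iff hV hz hy).1 ((h z ((isTv_iff_exists_hasFlag hV z).2 ⟨_, _, hz⟩)).1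
        ((adj_iff hV hz hx).2 (Or.inr rfl))) with h2 | h2
      · exact hqp (h2.trans hp.symm)
      · exact hne hp h2
    · obtain ⟨K, hK, hKH, hpK, -⟩ := exists_isCoatom_ge hV hx.isAtom hx.isAtom H
      obtain ⟨z, hz⟩ := exists_hasFlag hx.isAtom hK hpK
      rcases (adj_iff hV hz hy).1 ((h z ((isTv_iff_exists_hasFlag hV z).2 ⟨_, _, hz⟩)).1
        ((adj_iff hV hz hx).2 (Or.inl rfl))) with h2 | h2
      · exact hp h2
      · exact hKH (h2.trans (h1.resolve_left hp).symm)
  · rintro ⟨rfl, rfl⟩ z hz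
    obtain ⟨q, K, hz⟩ := (isTv_iff_exists_hasFlag hV z).1 hz
    rw [adj_iff hV hz hx, adj_iff hV hz hy]

/-- The pair `x`, `y` represents the common centre `p` of two transvections. -/
def IsCentreCode (p : Submodule D V) (x y : PGL D V) : Prop :=
  ∃ H K, H ≠ K ∧ HasFlag p H x ∧ HasFlag p K y

/-- The pair `x`, `y` represents the common axis `H` of two transvections. -/
def IsAxisCode (H : Submodule D V) (x y : PGL D V) : Prop :=
  ∃ p q, p ≠ q ∧ HasFlag p H x ∧ HasFlag q H y

theorem isCode_iff (hV : ¬ Module.Finite D V) (x y : PGL D V) :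
    IsCode x y ↔ (∃ p, IsCentreCode p x y) ∨ ∃ H, IsAxisCode H x y := by
  constructor
  · rintro ⟨hx, hy, h, h'⟩
    obtain ⟨p, H, hx⟩ := (isTv_iff_exists_hasFlag hV x).1 hx
    obtain ⟨q, K, hy⟩ := (isTv_iff_exists_hasFlag hV y).1 hy
    rw [sameFlag_iff hV hx hy] at h'
    rcases (adj_iff hV hx hy).1 h with rfl | rfl
    · exact Or.inl ⟨p, H, K, fun e => h' ⟨rfl, e⟩, hx, hy⟩
    · exact Or.inr ⟨H, p, q, fun e => h' ⟨e, rfl⟩, hx, hy⟩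
  · rintro (⟨p, H, K, hne, hx, hy⟩ | ⟨H, p, q, hne, hx, hy⟩)
    · refine ⟨(isTv_iff_exists_hasFlag hV x).2 ⟨_, _, hx⟩,
        (isTv_iff_exists_hasFlag hV y).2 ⟨_, _, hy⟩, (adj_iff hV hx hy).2 (Or.inl rfl), ?_⟩
      rw [sameFlag_iff hV hx hy]
      exact fun h => hne h.2
    · refine ⟨(isTv_iff_exists_hasFlag hV x).2 ⟨_, _, hx⟩,
        (isTv_iff_exists_hasFlag hV y).2 ⟨_, _, hy⟩, (adj_iff hV hx hy).2 (Or.inr rfl), ?_⟩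
      rw [sameFlag_iff hV hx hy]
      exact fun h => hne h.1

theorem IsCentreCode.mem_iff (hV : ¬ Module.Finite D V) {p : Submodule D V} {x y : PGL D V}
    (h : IsCentreCode p x y) {q K : Submodule D V} {z : PGL D V} (hz : HasFlag q K z) :
    Mem x y z ↔ q = p := by
  obtain ⟨H, H', hne, hx, hy⟩ := h
  rw [Mem, adj_iff hV hz hx, adj_iff hV hz hy, isTv_iff_exists_hasFlag hV]
  constructor
  · rintro ⟨-, h1 | h1, h2 | h2⟩
    exacts [h1, h1, h2, absurd (h1.symm.trans h2) hne]
  · exact fun h => ⟨⟨_, _, hz⟩, Or.inl h, Or.inl h⟩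

theorem IsAxisCode.mem_iff (hV : ¬ Module.Finite D V) {H : Submodule D V} {x y : PGL D V}
    (h : IsAxisCode H x y) {q K : Submodule D V} {z : PGL D V} (hz : HasFlag q K z) :
    Mem x y z ↔ K = H := by
  obtain ⟨p, p', hne, hx, hy⟩ := h
  rw [Mem, adj_iff hV hz hx, adj_iff hV hz hy, isTv_iff_exists_hasFlag hV]
  constructor
  · rintro ⟨-, h1 | h1, h2 | h2⟩
    exacts [absurd (h1.symm.trans h2) hne, h2, h1, h1]
  · exact fun h => ⟨⟨_, _, hz⟩, Or.inr h, Or.inr h⟩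

theorem IsCentreCode.isAtom {p : Submodule D V} {x y : PGL D V} (h : IsCentreCode p x y) :
    IsAtom p := by
  obtain ⟨H, H', -, hx, -⟩ := h
  exact hx.isAtom

theorem IsAxisCode.isCoatom {H : Submodule D V} {x y : PGL D V} (h : IsAxisCode H x y) :
    IsCoatom H := by
  obtain ⟨p, p', -, hx, -⟩ := h
  exact hx.isCoatom

theorem Mem.exists_hasFlag (hV : ¬ Module.Finite D V) {x y z : PGL D V} (h : Mem x y z) :
    ∃ p H, HasFlag p H z := (isTv_iff_exists_hasFlag hV z).1 h.1

theorem IsCentreCode.sameType (hV : ¬ Module.Finite D V) {p q : Submodule D V}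
    {c₁ c₂ x y : PGL D V} (hc : IsCentreCode p c₁ c₂) (h : IsCentreCode q x y) :
    SameType c₁ c₂ x y := by
  constructor
  · obtain ⟨H, hH, -, hpH, hqH⟩ := exists_isCoatom_ge hV hc.isAtom h.isAtom ⊥
    obtain ⟨a, ha⟩ := ProjRec.exists_hasFlag hc.isAtom hH hpH
    obtain ⟨b, hb⟩ := ProjRec.exists_hasFlag h.isAtom hH hqH
    exact ⟨a, b, (hc.mem_iff hV ha).2 rfl, (h.mem_iff hV hb).2 rfl,
      (adj_iff hV ha hb).2 (Or.inr rfl)⟩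
  · by_cases hpq : p = q
    · right
      intro a
      constructor <;> intro ha <;> obtain ⟨r, K, hr⟩ := ha.exists_hasFlag hV
      · rw [h.mem_iff hV hr, ← hpq, ← hc.mem_iff hV hr]; exact ha
      · rw [hc.mem_iff hV hr, hpq, ← h.mem_iff hV hr]; exact ha
    · left
      rintro a ⟨h1, h2⟩
      obtain ⟨r, K, hr⟩ := h1.exists_hasFlag hV
      exact hpq (((hc.mem_iff hV hr).1 h1).symm.trans ((h.mem_iff hV hr).1 h2))

theorem IsAxisCode.sameType (hV : ¬ Module.Finite D V) {H K : Submodule D V}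
    {c₁ c₂ x y : PGL D V} (hc : IsAxisCode H c₁ c₂) (h : IsAxisCode K x y) :
    SameType c₁ c₂ x y := by
  constructor
  · obtain ⟨p, hp, -, hpH, hpK⟩ := exists_isAtom_le hV hc.isCoatom h.isCoatom ⊥
    obtain ⟨a, ha⟩ := ProjRec.exists_hasFlag hp hc.isCoatom hpH
    obtain ⟨b, hb⟩ := ProjRec.exists_hasFlag hp h.isCoatom hpK
    exact ⟨a, b, (hc.mem_iff hV ha).2 rfl, (h.mem_iff hV hb).2 rfl,
      (adj_iff hV ha hb).2 (Or.inl rfl)⟩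
  · by_cases hpq : H = K
    · right
      intro a
      constructor <;> intro ha <;> obtain ⟨r, L, hr⟩ := ha.exists_hasFlag hV
      · rw [h.mem_iff hV hr, ← hpq, ← hc.mem_iff hV hr]; exact ha
      · rw [hc.mem_iff hV hr, hpq, ← h.mem_iff hV hr]; exact ha
    · left
      rintro a ⟨h1, h2⟩
      obtain ⟨r, L, hr⟩ := h1.exists_hasFlag hV
      exact hpq (((hc.mem_iff hV hr).1 h1).symm.trans ((h.mem_iff hV hr).1 h2))

theorem IsCentreCode.not_sameType (hV : ¬ Module.Finite D V) {p H : Submodule D V}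
    {c₁ c₂ x y : PGL D V} (hc : IsCentreCode p c₁ c₂) (h : IsAxisCode H x y) :
    ¬ SameType c₁ c₂ x y ∧ ¬ SameType x y c₁ c₂ := by
  -- if some members are adjacent then `p ≤ H`, and the two classes share the flag `(p, H)`
  have key : ∀ {a b}, Mem c₁ c₂ a → Mem x y b → (Adj a b ∨ Adj b a) → ∃ z, HasFlag p H z := by
    intro a b ha hb hab
    obtain ⟨q, K, hq⟩ := ha.exists_hasFlag hV
    obtain ⟨r, L, hr⟩ := hb.exists_hasFlag hV
    rw [adj_iff hV hq hr, adj_iff hV hr hq] at hab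
    obtain rfl := (hc.mem_iff hV hq).1 ha
    obtain rfl := (h.mem_iff hV hr).1 hb
    refine ProjRec.exists_hasFlag hc.isAtom h.isCoatom ?_
    rcases hab with (rfl | rfl) | (rfl | rfl)
    exacts [hr.le, hq.le, hr.le, hq.le]
  obtain ⟨K, hK, hKH, hpK, -⟩ := exists_isCoatom_ge hV hc.isAtom hc.isAtom H
  obtain ⟨w, hw⟩ := ProjRec.exists_hasFlag hc.isAtom hK hpK
  have hw1 : Mem c₁ c₂ w := (hc.mem_iff hV hw).2 rfl
  have hw2 : ¬ Mem x y w := fun h' => hKH ((h.mem_iff hV hw).1 h')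
  constructor
  · rintro ⟨⟨a, b, ha, hb, hab⟩, h' | h'⟩
    · obtain ⟨z, hz⟩ := key ha hb (Or.inl hab)
      exact h' z ⟨(hc.mem_iff hV hz).2 rfl, (h.mem_iff hV hz).2 rfl⟩
    · exact hw2 ((h' w).1 hw1)
  · rintro ⟨⟨a, b, ha, hb, hab⟩, h' | h'⟩
    · obtain ⟨z, hz⟩ := key hb ha (Or.inr hab)
      exact h' z ⟨(h.mem_iff hV hz).2 rfl, (hc.mem_iff hV hz).2 rfl⟩
    · exact hw2 ((h' w).2 hw1)

theorem IsCentreCode.partEq_iff (hV : ¬ Module.Finite D V) {c₁ c₂ x y : PGL D V}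
    {p q H q' H' : Submodule D V} (hc : IsCentreCode p c₁ c₂) (hx : HasFlag q H x)
    (hy : HasFlag q' H' y) : PartEq c₁ c₂ x y ↔ q = q' := by
  rw [PartEq, adj_iff hV hx hy, sameFlag_iff hV hx hy]
  by_cases h1 : q = q' <;> by_cases h2 : H = H'
  · simp [h1, h2]
  · subst h1
    simp [hc.sameType hV ⟨H, H', h2, hx, hy⟩]
  · subst h2
    simp [h1, (hc.not_sameType hV ⟨q, q', h1, hx, hy⟩).1]
  · simp [h1, h2]

theorem IsCentreCode.coPartEq_iff (hV : ¬ Module.Finite D V) {c₁ c₂ x y : PGL D V}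
    {p q H q' H' : Submodule D V} (hc : IsCentreCode p c₁ c₂) (hx : HasFlag q H x)
    (hy : HasFlag q' H' y) : CoPartEq c₁ c₂ x y ↔ H = H' := by
  rw [CoPartEq, adj_iff hV hx hy, sameFlag_iff hV hx hy]
  by_cases h1 : q = q' <;> by_cases h2 : H = H'
  · simp [h1, h2]
  · subst h1
    simp [h2, hc.sameType hV ⟨H, H', h2, hx, hy⟩]
  · subst h2
    simp [(hc.not_sameType hV ⟨q, q', h1, hx, hy⟩).1]
  · simp [h1, h2]

theorem IsAxisCode.partEq_iff (hV : ¬ Module.Finite D V) {c₁ c₂ x y : PGL D V}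
    {K q H q' H' : Submodule D V} (hc : IsAxisCode K c₁ c₂) (hx : HasFlag q H x)
    (hy : HasFlag q' H' y) : PartEq c₁ c₂ x y ↔ H = H' := by
  rw [PartEq, adj_iff hV hx hy, sameFlag_iff hV hx hy]
  by_cases h1 : q = q' <;> by_cases h2 : H = H'
  · simp [h1, h2]
  · subst h1
    have : IsCentreCode q x y := ⟨H, H', h2, hx, hy⟩
    simp [h2, (this.not_sameType hV hc).2]
  · subst h2
    simp [hc.sameType hV ⟨q, q', h1, hx, hy⟩]
  · simp [h1, h2]

theorem IsAxisCode.coPartEq_iff (hV : ¬ Module.Finite D V) {c₁ c₂ x y : PGL D V}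
    {K q H q' H' : Submodule D V} (hc : IsAxisCode K c₁ c₂) (hx : HasFlag q H x)
    (hy : HasFlag q' H' y) : CoPartEq c₁ c₂ x y ↔ q = q' := by
  rw [CoPartEq, adj_iff hV hx hy, sameFlag_iff hV hx hy]
  by_cases h1 : q = q' <;> by_cases h2 : H = H'
  · simp [h1, h2]
  · subst h1
    have : IsCentreCode q x y := ⟨H, H', h2, hx, hy⟩
    simp [(this.not_sameType hV hc).2]
  · subst h2
    simp [h1, hc.sameType hV ⟨q, q', h1, hx, hy⟩]
  · simp [h1, h2]

end Incidence

/-! ### Fixed points and fixed hyperplanes -/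

section FixedPoints

open Module Submodule

variable {D V : Type*} [DivisionRing D] [AddCommGroup V] [Module D V]

theorem eq_zero_of_eq_smul {N : V →ₗ[D] V} (hN : ∀ x, ∃ n : ℕ, (N ^ n) x = 0) {x : V} {d : D}
    (h : N x = d • x) : N x = 0 := by
  have h2 : ∀ n : ℕ, (N ^ n) x = d ^ n • x := by
    intro n
    induction n with
    | zero => simp
    | succ n ih => rw [pow_succ', Module.End.mul_apply, ih, map_smul, h, smul_smul, pow_succ]
  obtain ⟨n, hn⟩ := hN x
  rw [h2] at hn
  rcases smul_eq_zero.1 hn with h0 | h0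
  · rw [h, eq_zero_of_pow_eq_zero h0, zero_smul]
  · rw [h0, map_zero]

/-- The automorphism `1 + N` for a locally nilpotent endomorphism `N`. -/
noncomputable def oneAdd (N : V →ₗ[D] V) (hN : ∀ x, ∃ n : ℕ, (N ^ n) x = 0) : V ≃ₗ[D] V :=
  LinearEquiv.ofBijective (LinearMap.id + N) <| by
    constructor
    · rw [← LinearMap.ker_eq_bot, LinearMap.ker_eq_bot']
      intro x hx
      have h1 : x + N x = 0 := hx
      have h2 := eq_zero_of_eq_smul hN (x := x) (d := -1) (by
        rw [neg_one_smul]; exact eq_neg_of_add_eq_zero_right h1)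
      rwa [h2, add_zero] at h1
    · have key : ∀ (n : ℕ) x, (N ^ n) x = 0 → ∃ y, (LinearMap.id + N : V →ₗ[D] V) y = x := by
        intro n
        induction n with
        | zero => intro x hx; exact ⟨0, by simpa using hx.symm⟩
        | succ n ih =>
          intro x hx
          obtain ⟨y, hy⟩ := ih (N x) (by rwa [pow_succ, Module.End.mul_apply] at hx)
          exact ⟨x - y, by rw [map_sub, hy]; simp⟩
      intro x
      obtain ⟨n, hn⟩ := hN x
      exact key n x hn

theorem oneAdd_apply {N : V →ₗ[D] V} (hN : ∀ x, ∃ n : ℕ, (N ^ n) x = 0) (x : V) :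
    oneAdd N hN x = x + N x := rfl

/-- The intersection of all hyperplanes fixed by `k`. -/
def fixInf (k : PGL D V) : Submodule D V := sInf {H | IsCoatom H ∧ k.1 H = H}

/-- The span of all points fixed by `k`. -/
def fixSup (k : PGL D V) : Submodule D V := sSup {p | IsAtom p ∧ k.1 p = p}

theorem le_of_forall_isCoatom {A B : Submodule D V} (h : ∀ H, IsCoatom H → A ≤ H → B ≤ H) :
    B ≤ A := by
  intro x hx
  by_contra hA
  obtain ⟨φ, hφ, hφ'⟩ := exists_le_ker_of_notMem hA
  exact hφ (h _ (isCoatom_ker fun h => hφ (by rw [h]; rfl)) hφ' hx)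

theorem le_of_forall_isAtom {A B : Submodule D V} (h : ∀ p, IsAtom p → p ≤ A → p ≤ B) :
    A ≤ B := by
  intro x hx
  by_cases hx0 : x = 0
  · rw [hx0]; exact zero_mem _
  · exact (span_singleton_le_iff_mem _ _).1
      (h _ (nonzero_span_atom x hx0) ((span_singleton_le_iff_mem _ _).2 hx))

theorem fixSup_oneAdd {N : V →ₗ[D] V} (hN : ∀ x, ∃ n : ℕ, (N ^ n) x = 0) :
    fixSup (proj (oneAdd N hN)) = LinearMap.ker N := by
  apply le_antisymm
  · refine sSup_le ?_
    rintro p ⟨hp, hk⟩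
    obtain ⟨x, hx, rfl⟩ := exists_span_eq_of_isAtom hp
    rw [span_singleton_le_iff_mem, LinearMap.mem_ker]
    have h1 : x + N x ∈ (proj (oneAdd N hN)).1 (span D {x}) :=
      ⟨x, mem_span_singleton_self x, rfl⟩
    rw [hk] at h1
    obtain ⟨c, hc⟩ := mem_span_singleton.1 h1
    refine eq_zero_of_eq_smul hN (d := c - 1) ?_
    rw [sub_smul, hc, one_smul]; abel
  · refine le_of_forall_isAtom fun p hp hle => le_sSup ⟨hp, ?_⟩
    rw [proj_apply]
    have : ∀ x ∈ p, oneAdd N hN x = x := fun x hx => by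
      rw [oneAdd_apply, show N x = 0 from hle hx, add_zero]
    apply le_antisymm
    · rintro _ ⟨x, hx, rfl⟩
      exact (this x hx).symm ▸ hx
    · intro x hx
      exact ⟨x, hx, this x hx⟩

theorem fixInf_oneAdd {N : V →ₗ[D] V} (hN : ∀ x, ∃ n : ℕ, (N ^ n) x = 0) :
    fixInf (proj (oneAdd N hN)) = LinearMap.range N := by
  apply le_antisymm
  · refine le_of_forall_isCoatom fun H hH hle => sInf_le ⟨hH, ?_⟩
    rw [proj_apply]
    have hNH : ∀ x, N x ∈ H := fun x => hle ⟨x, rfl⟩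
    apply le_antisymm
    · rintro _ ⟨x, hx, rfl⟩
      exact H.add_mem hx (hNH x)
    · intro x hx
      obtain ⟨y, rfl⟩ := (oneAdd N hN).surjective x
      refine ⟨y, ?_, rfl⟩
      rw [oneAdd_apply] at hx
      exact (H.add_mem_iff_left (hNH y)).1 hx
  · refine le_sInf ?_
    rintro H ⟨hH, hk⟩
    obtain ⟨φ, hφ, rfl⟩ := exists_ker_eq_of_isCoatom hH
    have h1 : LinearMap.ker φ ≤ LinearMap.ker (φ ∘ₗ N) := by
      intro x hx
      have h2 : x + N x ∈ LinearMap.ker φ := by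
        rw [← hk]
        exact ⟨x, hx, rfl⟩
      exact ((LinearMap.ker φ).add_mem_iff_right hx).1 h2
    obtain ⟨d, hd⟩ := exists_eq_mul_of_ker_le hφ h1
    have h2 : ∀ (n : ℕ) x, φ ((N ^ n) x) = φ x * d ^ n := by
      intro n
      induction n with
      | zero => simp
      | succ n ih =>
        intro x
        rw [pow_succ', Module.End.mul_apply]
        exact (hd _).trans (by rw [ih, pow_succ, mul_assoc])
    obtain ⟨y, hy⟩ := exists_dual_eq_one hφ
    obtain ⟨n, hn⟩ := hN y
    have h3 := h2 n y
    rw [hn, map_zero, hy, one_mul] at h3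
    have hd0 : d = 0 := eq_zero_of_pow_eq_zero h3.symm
    rintro _ ⟨x, rfl⟩
    exact (hd x).trans (by rw [hd0, mul_zero])

/-- Every subspace is the range of a locally nilpotent endomorphism: of a backward shift if the
subspace has infinite dimension, and of an endomorphism of square zero otherwise. -/
theorem exists_locally_nilpotent_range (hV : ¬ Module.Finite D V) (L : Submodule D V) :
    ∃ N : V →ₗ[D] V, (∀ x, ∃ n : ℕ, (N ^ n) x = 0) ∧ LinearMap.range N = L := by
  obtain ⟨C, hC⟩ := Submodule.exists_isCompl L
  set e := prodEquivOfIsCompl L C hC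
  have heL : ∀ x : L, e.symm x = (x, 0) := fun x => by
    rw [LinearEquiv.symm_apply_eq]; simp [e]
  by_cases hL : Module.Finite D L
  · have hCinf : ¬ Module.Finite D C := fun _ => hV (Module.Finite.equiv e)
    obtain ⟨f⟩ := nonempty_prod_linearEquiv (D := D) (P := L) hCinf
    let N : V →ₗ[D] V := L.subtype ∘ₗ LinearMap.fst D L C ∘ₗ f.symm.toLinearMap ∘ₗ
      LinearMap.snd D L C ∘ₗ e.symm.toLinearMap
    refine ⟨N, fun x => ⟨2, ?_⟩, le_antisymm ?_ ?_⟩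
    · rw [pow_two, Module.End.mul_apply]
      simp [N, heL]
    · rintro _ ⟨x, rfl⟩
      simp [N]
    · intro x hx
      refine ⟨f (⟨x, hx⟩, 0), ?_⟩
      have : e.symm (f (⟨x, hx⟩, 0) : C) = (0, f (⟨x, hx⟩, 0)) := by
        rw [LinearEquiv.symm_apply_eq]; simp [e]
      simp [N, this]
  · let b₀ := Basis.ofVectorSpace D L
    have hinf : Infinite (Basis.ofVectorSpaceIndex D L) := by
      by_contra h
      rw [not_infinite_iff_finite] at h
      exact hL (Module.Finite.of_basis b₀)
    have hcard : Cardinal.mk (Basis.ofVectorSpaceIndex D L) =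
        Cardinal.mk (Basis.ofVectorSpaceIndex D L × ℕ) := by
      rw [Cardinal.mk_prod, Cardinal.lift_uzero, Cardinal.mk_nat, Cardinal.lift_aleph0,
        Cardinal.mul_eq_left (Cardinal.aleph0_le_mk _) (Cardinal.aleph0_le_mk _)
          Cardinal.aleph0_ne_zero]
    obtain ⟨σ⟩ := Cardinal.eq.1 hcard
    let b := b₀.reindex σ
    let S : L →ₗ[D] L := b.constr ℕ fun i => Nat.casesOn i.2 0 fun n => b (i.1, n)
    have hS0 : ∀ i, S (b (i, 0)) = 0 := fun i => b.constr_basis ℕ _ _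
    have hS1 : ∀ i n, S (b (i, n + 1)) = b (i, n) := fun i n => b.constr_basis ℕ _ _
    have hSnil : ∀ x, ∃ n : ℕ, (S ^ n) x = 0 := by
      intro x
      have hx : x ∈ span D (Set.range b) := by rw [b.span_eq]; trivial
      induction hx using Submodule.span_induction with
      | mem x hx =>
        obtain ⟨⟨i, n⟩, rfl⟩ := hx
        refine ⟨n + 1, ?_⟩
        induction n with
        | zero => simpa using hS0 i
        | succ n ih => rw [pow_succ, Module.End.mul_apply, hS1, ih]
      | zero => exact ⟨0, map_zero _⟩
      | add x y _ _ hx hy =>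
        obtain ⟨n, hn⟩ := hx
        obtain ⟨m, hm⟩ := hy
        refine ⟨n + m, ?_⟩
        rw [map_add, pow_add, Module.End.mul_apply _ _ y, hm, map_zero, ← pow_add, add_comm n m,
          pow_add, Module.End.mul_apply, hn, map_zero, add_zero]
      | smul a x _ hx =>
        obtain ⟨n, hn⟩ := hx
        exact ⟨n, by rw [map_smul, hn, smul_zero]⟩
    have hSsurj : Function.Surjective S := by
      rw [← LinearMap.range_eq_top, eq_top_iff, ← b.span_eq, span_le]
      rintro _ ⟨⟨i, n⟩, rfl⟩
      exact ⟨b (i, n + 1), hS1 i n⟩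
    let N : V →ₗ[D] V := L.subtype ∘ₗ S ∘ₗ LinearMap.fst D L C ∘ₗ e.symm.toLinearMap
    have hNL : ∀ (n : ℕ) (x : L), (N ^ n) x = (S ^ n) x := by
      intro n
      induction n with
      | zero => simp
      | succ n ih =>
        intro x
        rw [pow_succ', Module.End.mul_apply, ih, pow_succ', Module.End.mul_apply]
        simp [N, heL]
    refine ⟨N, fun x => ?_, le_antisymm ?_ ?_⟩
    · obtain ⟨n, hn⟩ := hSnil (S (e.symm x).1)
      refine ⟨n + 1, ?_⟩
      rw [pow_succ, Module.End.mul_apply]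
      change (N ^ n) (S (e.symm x).1 : L) = 0
      rw [hNL, hn, coe_zero]
    · rintro _ ⟨x, rfl⟩
      simp [N]
    · intro x hx
      obtain ⟨y, hy⟩ := hSsurj ⟨x, hx⟩
      exact ⟨y, by simp [N, heL, hy]⟩

/-- Every subspace is the intersection of the hyperplanes fixed by some element. -/
theorem fixInf_surjective (hV : ¬ Module.Finite D V) :
    Function.Surjective (fixInf (D := D) (V := V)) := by
  intro L
  obtain ⟨N, hN, rfl⟩ := exists_locally_nilpotent_range hV L
  exact ⟨_, fixInf_oneAdd hN⟩

end FixedPoints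

/-! ### A descending chain of translates of a subspace -/

section Shift

open Module Submodule

variable {D V : Type*} [DivisionRing D] [AddCommGroup V] [Module D V]

theorem exists_basis_int_sum (hV : ¬ Module.Finite D V) :
    ∃ ι : Set V, Nonempty ι ∧ Nonempty (Basis (ℤ ⊕ ι) D V) := by
  let b := Basis.ofVectorSpace D V
  have hinf : Infinite (Basis.ofVectorSpaceIndex D V) := by
    by_contra h
    rw [not_infinite_iff_finite] at h
    exact hV (Module.Finite.of_basis b)
  have hcard : Cardinal.mk (Basis.ofVectorSpaceIndex D V) =
      Cardinal.mk (ℤ ⊕ Basis.ofVectorSpaceIndex D V) := by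
    rw [Cardinal.mk_sum, Cardinal.lift_uzero, Cardinal.mk_int, Cardinal.lift_aleph0,
      Cardinal.add_eq_right (Cardinal.aleph0_le_mk _) (Cardinal.aleph0_le_mk _)]
  obtain ⟨σ⟩ := Cardinal.eq.1 hcard
  exact ⟨_, inferInstance, ⟨b.reindex σ⟩⟩

section

variable {ι : Type*} (b : Basis (ℤ ⊕ ι) D V)

/-- The automorphism that moves the basis vector with index `n : ℤ` to the one with index `n + m`
and fixes the basis vectors with indices in `ι`. -/
noncomputable def shift (m : ℤ) : V ≃ₗ[D] V :=
  b.equiv b ((Equiv.addRight m).sumCongr (Equiv.refl ι))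

theorem shift_inl (m n : ℤ) : shift b m (b (Sum.inl n)) = b (Sum.inl (n + m)) := by
  simp [shift]

theorem shift_inr (m : ℤ) (i : ι) : shift b m (b (Sum.inr i)) = b (Sum.inr i) := by
  simp [shift]

theorem repr_shift_inl (m n : ℤ) (x : V) :
    b.repr (shift b m x) (Sum.inl n) = b.repr x (Sum.inl (n - m)) := by
  classical
  have : ((Finsupp.lapply (Sum.inl n) : _ →ₗ[D] D) ∘ₗ b.repr.toLinearMap ∘ₗ
      (shift b m).toLinearMap) =
      (Finsupp.lapply (Sum.inl (n - m)) : _ →ₗ[D] D) ∘ₗ b.repr.toLinearMap := by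
    refine b.ext fun i => ?_
    rcases i with k | i
    · have : (Sum.inl (k + m) : ℤ ⊕ ι) = Sum.inl n ↔ (Sum.inl k : ℤ ⊕ ι) = Sum.inl (n - m) := by
        rw [Sum.inl.injEq, Sum.inl.injEq]; omega
      simp only [LinearMap.comp_apply, LinearEquiv.coe_coe, shift_inl, b.repr_self,
        Finsupp.lapply_apply, Finsupp.single_apply, this]
    · simp [shift_inr]
  exact LinearMap.congr_fun this x

theorem shift_mul (m n : ℤ) : shift b m * shift b n = shift b n * shift b m := by
  have : ∀ k l : ℤ, (shift b k * shift b l : V ≃ₗ[D] V) = shift b (l + k) := by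
    intro k l
    apply LinearEquiv.toLinearMap_injective
    refine b.ext fun i => ?_
    rcases i with j | i
    · simp [shift_inl, add_assoc]
    · simp [shift_inr]
  rw [this, this, add_comm]

/-- The vectors whose coordinates with index `n < m` vanish. -/
def tail (m : ℤ) : Submodule D V where
  carrier := {x | ∀ n < m, b.repr x (Sum.inl n) = 0}
  add_mem' := fun hx hy n hn => by rw [map_add, Finsupp.add_apply, hx n hn, hy n hn, add_zero]
  zero_mem' := fun n _ => by rw [map_zero, Finsupp.zero_apply]
  smul_mem' := fun c x hx n hn => by rw [map_smul, Finsupp.smul_apply, hx n hn, smul_zero]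

theorem mem_tail {m : ℤ} {x : V} : x ∈ tail b m ↔ ∀ n < m, b.repr x (Sum.inl n) = 0 := Iff.rfl

theorem tail_antitone : Antitone (tail b) := fun _ _ h _ hx n hn => hx n (hn.trans_le h)

theorem map_shift_tail (m n : ℤ) : (tail b n).map (shift b m : V →ₗ[D] V) = tail b (n + m) := by
  ext x
  constructor
  · rintro ⟨y, hy, rfl⟩ k hk
    rw [LinearEquiv.coe_coe, repr_shift_inl]
    exact hy _ (by omega)
  · intro hx
    obtain ⟨y, rfl⟩ := (shift b m).surjective x
    refine ⟨y, fun k hk => ?_, rfl⟩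
    have := hx (k + m) (by omega)
    rwa [repr_shift_inl, add_sub_cancel_right] at this

/-- The order of vanishing of a vector with some non-zero coordinate in `ℤ`. -/
theorem exists_order {x : V} (hx : ∃ n, b.repr x (Sum.inl n) ≠ 0) :
    ∃ n, x ∈ tail b n ∧ b.repr x (Sum.inl n) ≠ 0 := by
  classical
  let s : Finset ℤ := (b.repr x).support.preimage Sum.inl Sum.inl_injective.injOn
  have hs : ∀ n, n ∈ s ↔ b.repr x (Sum.inl n) ≠ 0 := fun n => by simp [s]
  have hne : s.Nonempty := hx.imp fun n hn => (hs n).2 hn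
  refine ⟨s.min' hne, fun n hn => ?_, (hs _).1 (s.min'_mem hne)⟩
  by_contra h
  exact absurd (s.min'_le n ((hs n).2 h)) (not_le.2 hn)

theorem shift_eq_self_of_forall {x : V} (hx : ∀ n, b.repr x (Sum.inl n) = 0) (m : ℤ) :
    shift b m x = x := by
  rw [← b.linearCombination_repr x, Finsupp.linearCombination_apply, Finsupp.sum, map_sum]
  refine Finset.sum_congr rfl fun i _ => ?_
  rcases i with n | i
  · rw [hx, zero_smul, map_zero]
  · rw [map_smul, shift_inr]

/-- An eigenvector of the shift has no coordinates in `ℤ`. -/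
theorem repr_inl_eq_zero_of_eq_smul {x : V} {c : D} (h : x = c • shift b 1 x) (n : ℤ) :
    b.repr x (Sum.inl n) = 0 := by
  by_contra hne
  obtain ⟨m, hm, hm'⟩ := exists_order b ⟨n, hne⟩
  apply hm'
  rw [h, map_smul, Finsupp.smul_apply, repr_shift_inl, hm _ (by omega), smul_zero]

/-- An automorphism that commutes with the shift in the projective group commutes with it. -/
theorem commute_shift_of_proj [Nonempty ι] {h : V ≃ₗ[D] V}
    (hc : proj h * proj (shift b 1) = proj (shift b 1) * proj h) :
    h * shift b 1 = shift b 1 * h := by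
  have hq : proj (h * shift b 1 * (shift b 1 * h)⁻¹) = 1 := by
    rw [map_mul, map_inv, map_mul, map_mul, hc, mul_inv_cancel]
  set q := h * shift b 1 * (shift b 1 * h)⁻¹ with hqdef
  have hq2 : h * shift b 1 = q * (shift b 1 * h) := by rw [hqdef, inv_mul_cancel_right]
  obtain ⟨i⟩ := ‹Nonempty ι›
  set w := h (b (Sum.inr i)) with hw
  have hw0 : w ≠ 0 := h.map_ne_zero_iff.2 (b.ne_zero _)
  have h1 : q (shift b 1 w) = w := by
    have := LinearEquiv.congr_fun hq2 (b (Sum.inr i))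
    rw [LinearEquiv.mul_apply, shift_inr, LinearEquiv.mul_apply, LinearEquiv.mul_apply] at this
    exact this.symm
  have h2 := proj_eq_one_iff.1 hq (shift b 1 w)
  rw [h1] at h2
  obtain ⟨c, hc⟩ := mem_span_singleton.1 h2
  have h3 := shift_eq_self_of_forall b (repr_inl_eq_zero_of_eq_smul b hc.symm) 1
  rw [h3] at h1
  rw [hq2, eq_one_of_proj_eq_one hq hw0 h1, one_mul]

/-- An automorphism that commutes with the shift changes the order of all vectors by the same
amount: the tails are only translated. -/
theorem exists_map_tail_eq {h : V ≃ₗ[D] V} (hc : h * shift b 1 = shift b 1 * h) :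
    ∃ m, (tail b 0).map (h : V →ₗ[D] V) = tail b m := by
  classical
  have hc1 : ∀ x, h (shift b 1 x) = shift b 1 (h x) := fun x => LinearEquiv.congr_fun hc x
  -- `h` and its inverse preserve the vectors without coordinates in `ℤ`
  have hW : ∀ {k : V ≃ₗ[D] V}, (∀ x, k (shift b 1 x) = shift b 1 (k x)) →
      ∀ {x : V}, (∀ n, b.repr x (Sum.inl n) = 0) → ∀ n, b.repr (k x) (Sum.inl n) = 0 := by
    intro k hk x hx
    refine repr_inl_eq_zero_of_eq_smul b (c := 1) ?_
    rw [one_smul, ← hk, shift_eq_self_of_forall b hx]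
  have hc2 : ∀ x, h.symm (shift b 1 x) = shift b 1 (h.symm x) := fun x => by
    rw [LinearEquiv.symm_apply_eq, hc1, LinearEquiv.apply_symm_apply]
  set e := b (Sum.inl 0) with he
  obtain ⟨m, hm, hm'⟩ : ∃ m, h e ∈ tail b m ∧ b.repr (h e) (Sum.inl m) ≠ 0 := by
    refine exists_order b ?_
    by_contra! H
    have := hW hc2 H 0
    rw [LinearEquiv.symm_apply_apply, he, b.repr_self, Finsupp.single_eq_same] at this
    exact one_ne_zero this
  have hb : ∀ n : ℤ, ∀ k, b.repr (h (b (Sum.inl n))) (Sum.inl k) =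
      b.repr (h e) (Sum.inl (k - n)) := by
    have step : ∀ n k, b.repr (h (b (Sum.inl (n + 1)))) (Sum.inl k) =
        b.repr (h (b (Sum.inl n))) (Sum.inl (k - 1)) := fun n k => by
      rw [← shift_inl, hc1, repr_shift_inl]
    intro n
    induction n with
    | zero => intro k; rw [sub_zero]
    | succ n ih => intro k; rw [step, ih]; congr 2; omega
    | pred n ih =>
      intro k
      have := step (-(n : ℤ) - 1) (k + 1)
      rw [sub_add_cancel, ih, add_sub_cancel_right] at this
      rw [← this]; congr 2; omega
  have h1 : ∀ {j x}, x ∈ tail b j → h x ∈ tail b (j + m) := by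
    intro j x hx
    rw [← b.linearCombination_repr x, Finsupp.linearCombination_apply, Finsupp.sum, map_sum]
    refine sum_mem fun i _ => ?_
    rw [map_smul]
    rcases i with n | i
    · by_cases hn : n < j
      · rw [hx n hn, zero_smul]; exact zero_mem _
      · refine smul_mem _ _ fun k hk => ?_
        rw [hb]
        exact hm _ (by omega)
    · refine smul_mem _ _ fun k _ => hW hc1 (fun n => ?_) k
      simp
  have h2 : ∀ {j x}, x ∈ tail b j → b.repr x (Sum.inl j) ≠ 0 →
      b.repr (h x) (Sum.inl (j + m)) ≠ 0 := by
    intro j x hx hx'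
    set y := x - b.repr x (Sum.inl j) • b (Sum.inl j) with hy
    have hyt : y ∈ tail b (j + 1) := by
      intro n hn
      rw [hy, map_sub, map_smul, b.repr_self, Finsupp.sub_apply, Finsupp.smul_apply]
      by_cases hnj : n = j
      · subst hnj; simp
      · rw [hx n (by omega), Finsupp.single_apply, if_neg (by simpa using Ne.symm hnj)]; simp
    have hxy : x = b.repr x (Sum.inl j) • b (Sum.inl j) + y := by rw [hy]; abel
    have hval : b.repr (h x) (Sum.inl (j + m)) =
        b.repr x (Sum.inl j) • b.repr (h e) (Sum.inl m) := by
      conv_lhs => rw [hxy]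
      rw [map_add, map_add, Finsupp.add_apply, h1 hyt _ (by omega), add_zero, map_smul, map_smul,
        Finsupp.smul_apply, hb, add_sub_cancel_left]
    rw [hval]
    exact smul_ne_zero hx' hm'
  refine ⟨m, le_antisymm ?_ ?_⟩
  · rintro _ ⟨x, hx, rfl⟩
    simpa using h1 hx
  · intro y hy
    obtain ⟨x, rfl⟩ := h.surjective y
    refine ⟨x, fun n hn => ?_, rfl⟩
    by_contra hne
    obtain ⟨j, hj, hj'⟩ := exists_order b ⟨n, hne⟩
    have hjn : j ≤ n := by
      by_contra hlt
      exact hne (hj n (by omega))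
    exact h2 hj hj' (hy _ (by omega))

/-- The square-zero endomorphism that maps the basis vector with index `-n - 1` to the one with
index `n`, for all natural numbers `n`, and the other basis vectors to zero. -/
noncomputable def fold : V →ₗ[D] V :=
  b.repr.symm.toLinearMap ∘ₗ Finsupp.lmapDomain D D (fun n : ℕ => (Sum.inl (n : ℤ) : ℤ ⊕ ι)) ∘ₗ
    Finsupp.lcomapDomain (fun n : ℕ => (Sum.inl (-(n : ℤ) - 1) : ℤ ⊕ ι))
      (fun m n h => by simpa using h) ∘ₗ b.repr.toLinearMap

theorem ker_fold : LinearMap.ker (fold b) = tail b 0 := by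
  have hinj : Function.Injective (fun n : ℕ => (Sum.inl (n : ℤ) : ℤ ⊕ ι)) :=
    fun m n h => by simpa using h
  ext x
  rw [LinearMap.mem_ker, mem_tail]
  simp only [fold, LinearMap.comp_apply, LinearEquiv.coe_coe, LinearEquiv.map_eq_zero_iff]
  rw [Finsupp.lmapDomain_apply, ← Finsupp.mapDomain_zero, (Finsupp.mapDomain_injective hinj).eq_iff,
    Finsupp.ext_iff]
  constructor
  · intro h n hn
    have := h (-n - 1).toNat
    have e : -(((-n - 1).toNat : ℕ) : ℤ) - 1 = n := by omega
    change b.repr x (Sum.inl (-(((-n - 1).toNat : ℕ) : ℤ) - 1)) = 0 at this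
    rwa [e] at this
  · intro h n
    exact h _ (by omega)

theorem fold_mem_ker (x : V) : fold b x ∈ LinearMap.ker (fold b) := by
  rw [ker_fold, mem_tail]
  intro n hn
  simp only [fold, LinearMap.comp_apply, LinearEquiv.coe_coe, LinearEquiv.apply_symm_apply]
  rw [Finsupp.lmapDomain_apply]
  refine Finsupp.mapDomain_of_notMem_range _ _ ?_
  rintro ⟨k, hk⟩
  have := Sum.inl_injective hk
  omega

end

end Shift

/-! ### Distinguishing centres from axes -/

section OrientationPredicates

variable {G : Type*} [Group G]

/-- Incidence of the `E`-part of `x` with the `E'`-part of `y`. If `E` is equality of centres and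
`E'` is equality of axes, then the centre of `x` lies on the axis of `y`. -/
def Inc (E E' : G → G → Prop) (x y : G) : Prop := ∃ z, IsTv z ∧ E x z ∧ E' z y

/-- The `E`-part of `x` is incident with the `E'`-parts of transvections fixed by `k`. If `E` is
equality of centres and `E'` is equality of axes, then the centre of `x` lies in `fixInf k`. -/
def InCode (E E' : G → G → Prop) (k x : G) : Prop :=
  ∀ y, IsTv y → E' (k * y * k⁻¹) y → Inc E E' x y

/-- Inclusion of the sets defined by `InCode`. -/
def CodeLe (E E' : G → G → Prop) (k l : G) : Prop :=
  ∀ x, IsTv x → InCode E E' k x → InCode E E' l x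

/-- The conjugates of some `k` by the centralizer of some `g` encode a chain of sets that has an
element of the closure of its union outside its union. This is impossible if the sets are subspaces
and the closure is the linear span. -/
def Bad (E E' : G → G → Prop) : Prop :=
  ∃ g k x : G, IsTv x ∧
    (∀ h, h * g = g * h → CodeLe E E' k (h * k * h⁻¹) ∨ CodeLe E E' (h * k * h⁻¹) k) ∧
    (∀ h, h * g = g * h → ¬ InCode E E' (h * k * h⁻¹) x) ∧
    ∀ y, IsTv y → (∀ h, h * g = g * h → ∀ z, IsTv z → InCode E E' (h * k * h⁻¹) z →
      Inc E E' z y) → Inc E E' x y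

/-- The inclusion of the subspaces `fixInf k` and `fixInf l`, expressed in the group. -/
def Le (k l : G) : Prop :=
  ∃ c₁ c₂ : G, IsCode c₁ c₂ ∧ ¬ Bad (PartEq c₁ c₂) (CoPartEq c₁ c₂) ∧
    CodeLe (PartEq c₁ c₂) (CoPartEq c₁ c₂) k l

end OrientationPredicates

section Orientation

open Module Submodule

variable {D V : Type*} [DivisionRing D] [AddCommGroup V] [Module D V]

/-- The action of the projective group preserves inclusion. -/
def pglOrderIso (g : PGL D V) : Submodule D V ≃o Submodule D V where
  toEquiv := g.1
  map_rel_iff' := by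
    intro a b
    obtain ⟨g, rfl⟩ := proj_surjective g
    rw [proj_apply, proj_apply]
    exact map_le_map_iff_of_injective g.injective a b

theorem apply_le_apply_iff (g : PGL D V) {a b : Submodule D V} : g.1 a ≤ g.1 b ↔ a ≤ b :=
  (pglOrderIso g).le_iff_le

theorem isCoatom_apply_iff (g : PGL D V) {a : Submodule D V} : IsCoatom (g.1 a) ↔ IsCoatom a :=
  (pglOrderIso g).isCoatom_iff a

theorem isAtom_apply_iff (g : PGL D V) {a : Submodule D V} : IsAtom (g.1 a) ↔ IsAtom a :=
  (pglOrderIso g).isAtom_iff a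

theorem le_fixInf_iff {A : Submodule D V} {k : PGL D V} :
    A ≤ fixInf k ↔ ∀ H, IsCoatom H → k.1 H = H → A ≤ H :=
  le_sInf_iff.trans ⟨fun h H h1 h2 => h H ⟨h1, h2⟩, fun h H hH => h H hH.1 hH.2⟩

theorem fixSup_le_iff {A : Submodule D V} {k : PGL D V} :
    fixSup k ≤ A ↔ ∀ p, IsAtom p → k.1 p = p → p ≤ A :=
  sSup_le_iff.trans ⟨fun h H h1 h2 => h H ⟨h1, h2⟩, fun h H hH => h H hH.1 hH.2⟩

theorem conj_apply_eq_iff (h k : PGL D V) (A : Submodule D V) :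
    (h * k * h⁻¹).1 (h.1 A) = h.1 A ↔ k.1 A = A := by
  have : (h * k * h⁻¹).1 (h.1 A) = h.1 (k.1 A) := by
    change h.1 (k.1 (h.1.symm (h.1 A))) = _
    rw [Equiv.symm_apply_apply]
  rw [this, h.1.injective.eq_iff]

theorem fixInf_conj (h k : PGL D V) : fixInf (h * k * h⁻¹) = h.1 (fixInf k) := by
  refine eq_of_forall_le_iff fun A => ?_
  obtain ⟨A, rfl⟩ := h.1.surjective A
  rw [apply_le_apply_iff h, le_fixInf_iff, le_fixInf_iff, h.1.surjective.forall]
  simp only [isCoatom_apply_iff h, conj_apply_eq_iff h, apply_le_apply_iff h]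

theorem fixSup_conj (h k : PGL D V) : fixSup (h * k * h⁻¹) = h.1 (fixSup k) := by
  refine eq_of_forall_ge_iff fun A => ?_
  obtain ⟨A, rfl⟩ := h.1.surjective A
  rw [apply_le_apply_iff h, fixSup_le_iff, fixSup_le_iff, h.1.surjective.forall]
  simp only [isAtom_apply_iff h, conj_apply_eq_iff h, apply_le_apply_iff h]

section Centre

variable {p : Submodule D V} {c₁ c₂ : PGL D V}

theorem IsCentreCode.inc_iff (hV : ¬ Module.Finite D V) (hc : IsCentreCode p c₁ c₂)
    {q H q' H' : Submodule D V} {x y : PGL D V} (hx : HasFlag q H x) (hy : HasFlag q' H' y) :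
    Inc (PartEq c₁ c₂) (CoPartEq c₁ c₂) x y ↔ q ≤ H' := by
  constructor
  · rintro ⟨z, hz, h1, h2⟩
    obtain ⟨r, K, hz⟩ := (isTv_iff_exists_hasFlag hV z).1 hz
    rw [hc.partEq_iff hV hx hz] at h1
    rw [hc.coPartEq_iff hV hz hy] at h2
    rw [h1, ← h2]
    exact hz.le
  · intro h
    obtain ⟨z, hz⟩ := exists_hasFlag hx.isAtom hy.isCoatom h
    exact ⟨z, (isTv_iff_exists_hasFlag hV z).2 ⟨_, _, hz⟩, (hc.partEq_iff hV hx hz).2 rfl,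
      (hc.coPartEq_iff hV hz hy).2 rfl⟩

theorem IsCentreCode.inCode_iff (hV : ¬ Module.Finite D V) (hc : IsCentreCode p c₁ c₂)
    {q H : Submodule D V} {k x : PGL D V} (hx : HasFlag q H x) :
    InCode (PartEq c₁ c₂) (CoPartEq c₁ c₂) k x ↔ q ≤ fixInf k := by
  rw [le_fixInf_iff]
  constructor
  · intro h K hK hkK
    obtain ⟨r, hr, -, hrK, -⟩ := exists_isAtom_le hV hK hK ⊥
    obtain ⟨y, hy⟩ := exists_hasFlag hr hK hrK
    exact (hc.inc_iff hV hx hy).1 (h y ((isTv_iff_exists_hasFlag hV y).2 ⟨_, _, hy⟩)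
      ((hc.coPartEq_iff hV (hy.conj k) hy).2 hkK))
  · intro h y hy hk
    obtain ⟨r, K, hy⟩ := (isTv_iff_exists_hasFlag hV y).1 hy
    exact (hc.inc_iff hV hx hy).2 (h K hy.isCoatom ((hc.coPartEq_iff hV (hy.conj k) hy).1 hk))

theorem exists_hasFlag_of_isAtom (hV : ¬ Module.Finite D V) {q : Submodule D V} (hq : IsAtom q) :
    ∃ H x, HasFlag q H x := by
  obtain ⟨H, hH, -, hqH, -⟩ := exists_isCoatom_ge hV hq hq ⊥
  exact ⟨H, exists_hasFlag hq hH hqH⟩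

theorem exists_hasFlag_of_isCoatom (hV : ¬ Module.Finite D V) {H : Submodule D V}
    (hH : IsCoatom H) : ∃ q x, HasFlag q H x := by
  obtain ⟨q, hq, -, hqH, -⟩ := exists_isAtom_le hV hH hH ⊥
  exact ⟨q, exists_hasFlag hq hH hqH⟩

theorem IsCentreCode.codeLe_iff (hV : ¬ Module.Finite D V) (hc : IsCentreCode p c₁ c₂)
    (k l : PGL D V) : CodeLe (PartEq c₁ c₂) (CoPartEq c₁ c₂) k l ↔ fixInf k ≤ fixInf l := by
  constructor
  · intro h
    refine le_of_forall_isAtom fun q hq hle => ?_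
    obtain ⟨H, x, hx⟩ := exists_hasFlag_of_isAtom hV hq
    exact (hc.inCode_iff hV hx).1 (h x ((isTv_iff_exists_hasFlag hV x).2 ⟨_, _, hx⟩)
      ((hc.inCode_iff hV hx).2 hle))
  · intro h x hx hk
    obtain ⟨q, H, hx⟩ := (isTv_iff_exists_hasFlag hV x).1 hx
    exact (hc.inCode_iff hV hx).2 (((hc.inCode_iff hV hx).1 hk).trans h)

/-- The union of a chain of subspaces is a subspace, hence an intersection of hyperplanes. -/
theorem IsCentreCode.not_bad (hV : ¬ Module.Finite D V) (hc : IsCentreCode p c₁ c₂) :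
    ¬ Bad (PartEq c₁ c₂) (CoPartEq c₁ c₂) := by
  rintro ⟨g, k, x, hx, hchain, hnot, hclos⟩
  obtain ⟨q, K, hx⟩ := (isTv_iff_exists_hasFlag hV x).1 hx
  obtain ⟨v, hv, rfl⟩ := exists_span_eq_of_isAtom hx.isAtom
  let C := {h : PGL D V // h * g = g * h}
  have : Nonempty C := ⟨⟨1, by simp⟩⟩
  let W : C → Submodule D V := fun h => fixInf (h.1 * k * h.1⁻¹)
  have hdir : Directed (· ≤ ·) W := by
    rintro ⟨h, hh⟩ ⟨h', hh'⟩
    have hcomm : (h⁻¹ * h') * g = g * (h⁻¹ * h') :=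
      (((show Commute h g from hh).inv_left).mul_left (show Commute h' g from hh')).eq
    -- compare `k` with its conjugate by `h⁻¹ * h'`, then conjugate by `h`
    have h1 := hchain _ hcomm
    rw [hc.codeLe_iff hV, hc.codeLe_iff hV, ← apply_le_apply_iff h,
      ← apply_le_apply_iff h (b := fixInf k), ← fixInf_conj, ← fixInf_conj,
      show h * (h⁻¹ * h' * k * (h⁻¹ * h')⁻¹) * h⁻¹ = h' * k * h'⁻¹ by group] at h1
    rcases h1 with h1 | h1
    · exact ⟨⟨h', hh'⟩, h1, le_rfl⟩
    · exact ⟨⟨h, hh⟩, le_rfl, h1⟩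
  have hvW : v ∉ ⨆ h, W h := by
    rw [mem_iSup_of_directed _ hdir]
    rintro ⟨⟨h, hh⟩, hvh⟩
    exact hnot h hh ((hc.inCode_iff hV hx).2 ((span_singleton_le_iff_mem _ _).2 hvh))
  obtain ⟨φ, hφ, hφ'⟩ := exists_le_ker_of_notMem hvW
  obtain ⟨r, y, hy⟩ := exists_hasFlag_of_isCoatom hV
    (isCoatom_ker (φ := φ) fun h => hφ (by rw [h]; rfl))
  have h2 := hclos y ((isTv_iff_exists_hasFlag hV y).2 ⟨_, _, hy⟩) fun h hh z hz hzh => by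
    obtain ⟨s, S, hz⟩ := (isTv_iff_exists_hasFlag hV z).1 hz
    refine (hc.inc_iff hV hz hy).2 ?_
    exact (((hc.inCode_iff hV hz).1 hzh).trans (le_iSup W ⟨h, hh⟩)).trans hφ'
  exact hφ ((span_singleton_le_iff_mem _ _).1 ((hc.inc_iff hV hx hy).1 h2))

end Centre

section Axis

variable {L : Submodule D V} {c₁ c₂ : PGL D V}

theorem IsAxisCode.inc_iff (hV : ¬ Module.Finite D V) (hc : IsAxisCode L c₁ c₂)
    {q H q' H' : Submodule D V} {x y : PGL D V} (hx : HasFlag q H x) (hy : HasFlag q' H' y) :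
    Inc (PartEq c₁ c₂) (CoPartEq c₁ c₂) x y ↔ q' ≤ H := by
  constructor
  · rintro ⟨z, hz, h1, h2⟩
    obtain ⟨r, K, hz⟩ := (isTv_iff_exists_hasFlag hV z).1 hz
    rw [hc.partEq_iff hV hx hz] at h1
    rw [hc.coPartEq_iff hV hz hy] at h2
    rw [h1, ← h2]
    exact hz.le
  · intro h
    obtain ⟨z, hz⟩ := exists_hasFlag hy.isAtom hx.isCoatom h
    exact ⟨z, (isTv_iff_exists_hasFlag hV z).2 ⟨_, _, hz⟩, (hc.partEq_iff hV hx hz).2 rfl,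
      (hc.coPartEq_iff hV hz hy).2 rfl⟩

theorem IsAxisCode.inCode_iff (hV : ¬ Module.Finite D V) (hc : IsAxisCode L c₁ c₂)
    {q H : Submodule D V} {k x : PGL D V} (hx : HasFlag q H x) :
    InCode (PartEq c₁ c₂) (CoPartEq c₁ c₂) k x ↔ fixSup k ≤ H := by
  rw [fixSup_le_iff]
  constructor
  · intro h r hr hkr
    obtain ⟨K, y, hy⟩ := exists_hasFlag_of_isAtom hV hr
    exact (hc.inc_iff hV hx hy).1 (h y ((isTv_iff_exists_hasFlag hV y).2 ⟨_, _, hy⟩)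
      ((hc.coPartEq_iff hV (hy.conj k) hy).2 hkr))
  · intro h y hy hk
    obtain ⟨r, K, hy⟩ := (isTv_iff_exists_hasFlag hV y).1 hy
    exact (hc.inc_iff hV hx hy).2 (h r hy.isAtom ((hc.coPartEq_iff hV (hy.conj k) hy).1 hk))

theorem IsAxisCode.codeLe_of_le (hV : ¬ Module.Finite D V) (hc : IsAxisCode L c₁ c₂)
    {k l : PGL D V} (h : fixSup l ≤ fixSup k) :
    CodeLe (PartEq c₁ c₂) (CoPartEq c₁ c₂) k l := by
  intro x hx hk
  obtain ⟨q, H, hx⟩ := (isTv_iff_exists_hasFlag hV x).1 hx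
  exact (hc.inCode_iff hV hx).2 (h.trans ((hc.inCode_iff hV hx).1 hk))

/-- If axes are taken for points, then conjugates of `k` encode the sets of hyperplanes through the
members of a descending chain of subspaces. For the tails of a basis that is partly indexed by `ℤ`,
the kernel of a linear form that vanishes on the intersection of the chain, but on none of its
members, belongs to the closure of the union of these sets and not to the union. -/
theorem IsAxisCode.bad (hV : ¬ Module.Finite D V) (hc : IsAxisCode L c₁ c₂) :
    Bad (PartEq c₁ c₂) (CoPartEq c₁ c₂) := by
  obtain ⟨ι, hι, ⟨b⟩⟩ := exists_basis_int_sum hV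
  have hN : ∀ x, ∃ n : ℕ, (fold b ^ n) x = 0 := fun x =>
    ⟨2, by rw [pow_two, Module.End.mul_apply]; exact fold_mem_ker b x⟩
  let φ : Dual D V := b.constr ℕ (Sum.elim (fun _ => 1) fun _ => 0)
  have hφl : ∀ n, φ (b (Sum.inl n)) = 1 := fun n => b.constr_basis ℕ _ _
  have hφr : ∀ i, φ (b (Sum.inr i)) = 0 := fun i => b.constr_basis ℕ _ _
  have hφ : φ ≠ 0 := fun h => by simpa [h] using hφl 0
  obtain ⟨q, x, hx⟩ := exists_hasFlag_of_isCoatom hV (isCoatom_ker hφ)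
  set g := proj (shift b 1)
  set k := proj (oneAdd (fold b) hN)
  have hk : fixSup k = tail b 0 := (fixSup_oneAdd hN).trans (ker_fold b)
  -- the translates of the tail by the centralizer of the shift
  have hconj : ∀ h, h * g = g * h → ∃ m, fixSup (h * k * h⁻¹) = tail b m := by
    intro h hh
    obtain ⟨h, rfl⟩ := proj_surjective h
    obtain ⟨m, hm⟩ := exists_map_tail_eq b (commute_shift_of_proj b hh)
    exact ⟨m, by rw [fixSup_conj, hk, proj_apply, hm]⟩
  have hshift : ∀ m, proj (shift b m) * g = g * proj (shift b m) := fun m => by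
    rw [← map_mul, shift_mul, map_mul]
  have hshift' : ∀ m, fixSup (proj (shift b m) * k * (proj (shift b m))⁻¹) = tail b m := fun m => by
    rw [fixSup_conj, hk, proj_apply, map_shift_tail, zero_add]
  refine ⟨g, k, x, (isTv_iff_exists_hasFlag hV x).2 ⟨_, _, hx⟩, fun h hh => ?_, fun h hh hin => ?_,
    fun y hy hall => ?_⟩
  · obtain ⟨m, hm⟩ := hconj h hh
    rcases le_total m 0 with h0 | h0
    · exact Or.inr (hc.codeLe_of_le hV (by rw [hm, hk]; exact tail_antitone b h0))
    · exact Or.inl (hc.codeLe_of_le hV (by rw [hm, hk]; exact tail_antitone b h0))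
  · obtain ⟨m, hm⟩ := hconj h hh
    rw [hc.inCode_iff hV hx, hm] at hin
    have hmem : b (Sum.inl m) ∈ tail b m := by
      intro n hn
      rw [b.repr_self, Finsupp.single_eq_of_ne]
      exact fun h => hn.ne (Sum.inl_injective h)
    exact one_ne_zero ((hφl m).symm.trans (hin hmem))
  · obtain ⟨r, K, hy⟩ := (isTv_iff_exists_hasFlag hV y).1 hy
    obtain ⟨w, hw, rfl⟩ := exists_span_eq_of_isAtom hy.isAtom
    -- the centre of `y` lies in all hyperplanes through some tail, hence in all tails
    have hw' : ∀ m, w ∈ tail b m := by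
      intro m
      by_contra hwm
      obtain ⟨ψ, hψ, hψ'⟩ := exists_le_ker_of_notMem hwm
      obtain ⟨s, z, hz⟩ := exists_hasFlag_of_isCoatom hV
        (isCoatom_ker (φ := ψ) fun h => hψ (by rw [h]; rfl))
      have h1 := hall _ (hshift m) z ((isTv_iff_exists_hasFlag hV z).2 ⟨_, _, hz⟩)
        ((hc.inCode_iff hV hz).2 (by rwa [hshift' m]))
      exact hψ ((span_singleton_le_iff_mem _ _).1 ((hc.inc_iff hV hz hy).1 h1))
    refine (hc.inc_iff hV hx hy).2 ((span_singleton_le_iff_mem _ _).2 ?_)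
    rw [LinearMap.mem_ker, ← b.linearCombination_repr w, Finsupp.linearCombination_apply,
      Finsupp.sum, map_sum]
    refine Finset.sum_eq_zero fun i _ => ?_
    rcases i with n | i
    · rw [hw' (n + 1) n (lt_add_one n), zero_smul, map_zero]
    · rw [map_smul, hφr, smul_zero]

end Axis

theorem exists_isCentreCode (hV : ¬ Module.Finite D V) :
    ∃ (p : Submodule D V) (c₁ c₂ : PGL D V), IsCentreCode p c₁ c₂ := by
  obtain ⟨φ, v, -, hv, -⟩ := exists_tv_data hV
  have hp := nonzero_span_atom (K := D) v hv
  obtain ⟨H, hH, -, hpH, -⟩ := exists_isCoatom_ge hV hp hp ⊥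
  obtain ⟨K, hK, hne, hpK, -⟩ := exists_isCoatom_ge hV hp hp H
  obtain ⟨x, hx⟩ := exists_hasFlag hp hH hpH
  obtain ⟨y, hy⟩ := exists_hasFlag hp hK hpK
  exact ⟨_, x, y, H, K, hne.symm, hx, hy⟩

theorem le_iff_fixInf_le (hV : ¬ Module.Finite D V) (k l : PGL D V) :
    Le k l ↔ fixInf k ≤ fixInf l := by
  constructor
  · rintro ⟨c₁, c₂, hcode, hbad, h⟩
    rcases (isCode_iff hV c₁ c₂).1 hcode with ⟨p, hc⟩ | ⟨H, hc⟩
    · exact (hc.codeLe_iff hV k l).1 h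
    · exact absurd (hc.bad hV) hbad
  · intro h
    obtain ⟨p, c₁, c₂, hc⟩ := exists_isCentreCode (D := D) (V := V) hV
    exact ⟨c₁, c₂, (isCode_iff hV c₁ c₂).2 (Or.inl ⟨p, hc⟩), hc.not_bad hV,
      (hc.codeLe_iff hV k l).2 h⟩

end Orientation

/-! ### Uniform definability in groups -/

section Definability

/-- The function `t` of tuples of group elements is given by one term in the language of groups,
uniformly in all groups. -/
def UTerm {α : Type} (t : ∀ (G : Type v) [Group G], (α → G) → G) : Prop :=
  ∃ τ : groupLang.Term α, ∀ (G : Type v) [Group G] (w : α → G), τ.realize w = t G w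

/-- The relation `P` between group elements is defined by one first-order formula, uniformly in all
groups. -/
def UDef {α : Type} (P : ∀ (G : Type v) [Group G], (α → G) → Prop) : Prop :=
  ∃ φ : groupLang.Formula α, ∀ (G : Type v) [Group G] (w : α → G), φ.Realize w ↔ P G w

variable {α : Type}

section Terms

variable {t s : ∀ (G : Type v) [Group G], (α → G) → G}

theorem UTerm.var (i : α) : UTerm fun (G : Type v) _ (w : α → G) => w i :=
  ⟨FirstOrder.Language.var i, fun _ _ _ => rfl⟩

theorem UTerm.one : UTerm fun (G : Type v) _ (_ : α → G) => (1 : G) :=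
  ⟨.func GroupFunc.one Fin.elim0, fun _ _ _ => rfl⟩

theorem UTerm.mul (ht : UTerm t) (hs : UTerm s) : UTerm fun G _ w => t G w * s G w := by
  obtain ⟨τ, hτ⟩ := ht
  obtain ⟨σ, hσ⟩ := hs
  exact ⟨.func GroupFunc.mul ![τ, σ], fun G _ w => congrArg₂ (· * ·) (hτ G w) (hσ G w)⟩

theorem UTerm.inv (ht : UTerm t) : UTerm fun G _ w => (t G w)⁻¹ := by
  obtain ⟨τ, hτ⟩ := ht
  exact ⟨.func GroupFunc.inv ![τ], fun G _ w => congrArg (·⁻¹) (hτ G w)⟩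

theorem UTerm.conj (ht : UTerm t) (hs : UTerm s) :
    UTerm fun G _ w => t G w * s G w * (t G w)⁻¹ := (ht.mul hs).mul ht.inv

theorem UTerm.commutator (ht : UTerm t) (hs : UTerm s) : UTerm fun G _ w => ⁅t G w, s G w⁆ :=
  ((ht.mul hs).mul ht.inv).mul hs.inv

/-- A term remains a term if a variable is added. -/
theorem UTerm.lift (ht : UTerm t) :
    UTerm fun G _ (w : α ⊕ Unit → G) => t G fun a => w (Sum.inl a) := by
  obtain ⟨τ, hτ⟩ := ht
  refine ⟨τ.relabel Sum.inl, fun G _ w => ?_⟩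
  rw [FirstOrder.Language.Term.realize_relabel, hτ]
  rfl

theorem UTerm.last : UTerm fun (G : Type v) _ (w : α ⊕ Unit → G) => w (Sum.inr ()) :=
  UTerm.var _

end Terms

section Formulas

variable {t s : ∀ (G : Type v) [Group G], (α → G) → G}
  {P Q : ∀ (G : Type v) [Group G], (α → G) → Prop}

theorem UDef.eq (ht : UTerm t) (hs : UTerm s) : UDef fun G _ w => t G w = s G w := by
  obtain ⟨τ, hτ⟩ := ht
  obtain ⟨σ, hσ⟩ := hs
  exact ⟨τ.equal σ, fun G _ w => by rw [FirstOrder.Language.Formula.realize_equal, hτ, hσ]⟩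

theorem UDef.not (hP : UDef P) : UDef fun G _ w => ¬ P G w := by
  obtain ⟨φ, hφ⟩ := hP
  exact ⟨φ.not, fun G _ w => by rw [FirstOrder.Language.Formula.realize_not, hφ]⟩

theorem UDef.ne (ht : UTerm t) (hs : UTerm s) : UDef fun G _ w => t G w ≠ s G w :=
  (UDef.eq ht hs).not

theorem UDef.and (hP : UDef P) (hQ : UDef Q) : UDef fun G _ w => P G w ∧ Q G w := by
  obtain ⟨φ, hφ⟩ := hP
  obtain ⟨ψ, hψ⟩ := hQ
  exact ⟨φ ⊓ ψ, fun G _ w => by rw [FirstOrder.Language.Formula.realize_inf, hφ, hψ]⟩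

theorem UDef.or (hP : UDef P) (hQ : UDef Q) : UDef fun G _ w => P G w ∨ Q G w := by
  obtain ⟨φ, hφ⟩ := hP
  obtain ⟨ψ, hψ⟩ := hQ
  exact ⟨φ ⊔ ψ, fun G _ w => by rw [FirstOrder.Language.Formula.realize_sup, hφ, hψ]⟩

theorem UDef.imp (hP : UDef P) (hQ : UDef Q) : UDef fun G _ w => P G w → Q G w := by
  obtain ⟨φ, hφ⟩ := hP
  obtain ⟨ψ, hψ⟩ := hQ
  exact ⟨φ.imp ψ, fun G _ w => by rw [FirstOrder.Language.Formula.realize_imp, hφ, hψ]⟩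

theorem UDef.iff (hP : UDef P) (hQ : UDef Q) : UDef fun G _ w => (P G w ↔ Q G w) := by
  obtain ⟨φ, hφ⟩ := hP
  obtain ⟨ψ, hψ⟩ := hQ
  exact ⟨φ.iff ψ, fun G _ w => by rw [FirstOrder.Language.Formula.realize_iff, hφ, hψ]⟩

variable {R : ∀ (G : Type v) [Group G], (α → G) → G → Prop}

theorem UDef.ex
    (hR : UDef fun G _ (w : α ⊕ Unit → G) => R G (fun a => w (Sum.inl a)) (w (Sum.inr ()))) :
    UDef fun G _ w => ∃ g, R G w g := by
  obtain ⟨φ, hφ⟩ := hR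
  refine ⟨φ.iExs Unit, fun G _ w => ?_⟩
  rw [FirstOrder.Language.Formula.realize_iExs]
  simp only [hφ]
  exact ⟨fun ⟨i, h⟩ => ⟨i (), h⟩, fun ⟨g, h⟩ => ⟨fun _ => g, h⟩⟩

theorem UDef.all
    (hR : UDef fun G _ (w : α ⊕ Unit → G) => R G (fun a => w (Sum.inl a)) (w (Sum.inr ()))) :
    UDef fun G _ w => ∀ g, R G w g := by
  obtain ⟨φ, hφ⟩ := (UDef.ex (R := fun G _ w g => ¬ R G w g) hR.not).not
  exact ⟨φ, fun G _ w => (hφ G w).trans not_exists_not⟩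

end Formulas

section Predicates

variable {t s c d : ∀ (G : Type v) [Group G], (α → G) → G}

theorem UDef.core (ht : UTerm t) : UDef fun G _ w => Core (t G w) :=
  .all <| .imp (.ne .last .one) <| .ex <| .ex <| .ex <| .eq ht.lift.lift.lift.lift <|
    .commutator (.commutator (.conj UTerm.last.lift.lift UTerm.last.lift.lift.lift)
      UTerm.last.lift) .last

theorem UDef.commOf {S : ∀ (G : Type v) [Group G], G → Prop}
    (hS : ∀ {β : Type} {t : ∀ (G : Type v) [Group G], (β → G) → G}, UTerm t →
      UDef fun G _ w => S G (t G w)) (ht : UTerm t) :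
    UDef fun G _ w => CommOf (S G) (t G w) :=
  .all <| .imp (hS .last) <| .imp (.ne .last .one) <| .ex <| .ex <| .eq ht.lift.lift.lift <|
    .commutator (.conj UTerm.last.lift UTerm.last.lift.lift) .last

theorem UDef.commOf_commOf_core (ht : UTerm t) :
    UDef fun G _ w => CommOf (CommOf Core) (t G w) :=
  UDef.commOf (S := fun _ _ => CommOf Core) (UDef.commOf (S := fun _ _ => Core) UDef.core) ht

theorem UDef.isTv (ht : UTerm t) : UDef fun G _ w => IsTv (t G w) :=
  .and (.ne ht .one) <| .and (.commOf_commOf_core ht) <| .all <|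
    .imp (.eq (.mul (.conj .last ht.lift) ht.lift) (.mul ht.lift (.conj .last ht.lift))) <|
      .commOf_commOf_core (.mul ht.lift (.conj .last ht.lift))

theorem UDef.adj (ht : UTerm t) (hs : UTerm s) : UDef fun G _ w => Adj (t G w) (s G w) :=
  .or (.eq ht hs) (.isTv (.mul ht hs.inv))

theorem UDef.sameFlag (ht : UTerm t) (hs : UTerm s) :
    UDef fun G _ w => SameFlag (t G w) (s G w) :=
  .all <| .imp (.isTv .last) <| .iff (.adj .last ht.lift) (.adj .last hs.lift)

theorem UDef.isCode (ht : UTerm t) (hs : UTerm s) : UDef fun G _ w => IsCode (t G w) (s G w) :=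
  .and (.isTv ht) <| .and (.isTv hs) <| .and (.adj ht hs) (UDef.sameFlag ht hs).not

theorem UDef.mem (hc : UTerm c) (ht : UTerm t) (hs : UTerm s) :
    UDef fun G _ w => Mem (c G w) (t G w) (s G w) :=
  .and (.isTv hs) <| .and (.adj hs hc) (.adj hs ht)

theorem UDef.sameType (hc : UTerm c) (hd : UTerm d) (ht : UTerm t) (hs : UTerm s) :
    UDef fun G _ w => SameType (c G w) (d G w) (t G w) (s G w) :=
  .and (.ex <| .ex <| .and (.mem hc.lift.lift hd.lift.lift UTerm.last.lift) <|
      .and (.mem ht.lift.lift hs.lift.lift .last) (.adj UTerm.last.lift .last)) <|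
    .or (.all <| .not <| .and (.mem hc.lift hd.lift .last) (.mem ht.lift hs.lift .last))
      (.all <| .iff (.mem hc.lift hd.lift .last) (.mem ht.lift hs.lift .last))

theorem UDef.partEq (hc : UTerm c) (hd : UTerm d) (ht : UTerm t) (hs : UTerm s) :
    UDef fun G _ w => PartEq (c G w) (d G w) (t G w) (s G w) :=
  .and (.adj ht hs) <| .or (.sameFlag ht hs) (.sameType hc hd ht hs)

theorem UDef.coPartEq (hc : UTerm c) (hd : UTerm d) (ht : UTerm t) (hs : UTerm s) :
    UDef fun G _ w => CoPartEq (c G w) (d G w) (t G w) (s G w) :=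
  .and (.adj ht hs) <| .or (.sameFlag ht hs) (UDef.sameType hc hd ht hs).not

theorem UDef.inc (hc : UTerm c) (hd : UTerm d) (ht : UTerm t) (hs : UTerm s) :
    UDef fun G _ w => Inc (PartEq (c G w) (d G w)) (CoPartEq (c G w) (d G w)) (t G w) (s G w) :=
  .ex <| .and (.isTv .last) <| .and (.partEq hc.lift hd.lift ht.lift .last)
    (.coPartEq hc.lift hd.lift .last hs.lift)

theorem UDef.inCode (hc : UTerm c) (hd : UTerm d) (ht : UTerm t) (hs : UTerm s) :
    UDef fun G _ w =>
      InCode (PartEq (c G w) (d G w)) (CoPartEq (c G w) (d G w)) (t G w) (s G w) :=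
  .all <| .imp (.isTv .last) <| .imp (.coPartEq hc.lift hd.lift (.conj ht.lift .last) .last)
    (.inc hc.lift hd.lift hs.lift .last)

theorem UDef.codeLe (hc : UTerm c) (hd : UTerm d) (ht : UTerm t) (hs : UTerm s) :
    UDef fun G _ w =>
      CodeLe (PartEq (c G w) (d G w)) (CoPartEq (c G w) (d G w)) (t G w) (s G w) :=
  .all <| .imp (.isTv .last) <| .imp (.inCode hc.lift hd.lift ht.lift .last)
    (.inCode hc.lift hd.lift hs.lift .last)

theorem UDef.bad (hc : UTerm c) (hd : UTerm d) :
    UDef fun G _ w => Bad (PartEq (c G w) (d G w)) (CoPartEq (c G w) (d G w)) := by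
  have hc4 := hc.lift.lift.lift.lift
  have hd4 := hd.lift.lift.lift.lift
  -- the variables `g`, `k`, `x`, `h` in their common scope
  have hg := (UTerm.last (α := α)).lift.lift.lift
  have hk := (UTerm.last (α := α ⊕ Unit)).lift.lift
  have hx := (UTerm.last (α := (α ⊕ Unit) ⊕ Unit)).lift
  have hh := UTerm.last (α := ((α ⊕ Unit) ⊕ Unit) ⊕ Unit)
  have hcomm := UDef.eq (.mul hh hg) (.mul hg hh)
  refine .ex <| .ex <| .ex <| .and (.isTv .last) <| .and ?_ <| .and ?_ ?_
  · exact .all <| .imp hcomm <|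
      .or (.codeLe hc4 hd4 hk (.conj hh hk)) (.codeLe hc4 hd4 (.conj hh hk) hk)
  · exact .all <| .imp hcomm <| .not <| .inCode hc4 hd4 (.conj hh hk) hx
  · refine .all <| .imp (.isTv .last) <| .imp ?_ <| .inc hc4 hd4 hx .last
    have hg' := (UTerm.last (α := α)).lift.lift.lift.lift
    have hk' := (UTerm.last (α := α ⊕ Unit)).lift.lift.lift
    have hh' := UTerm.last (α := (((α ⊕ Unit) ⊕ Unit) ⊕ Unit) ⊕ Unit)
    refine .all <| .imp (.eq (.mul hh' hg') (.mul hg' hh')) <| .all <| .imp (.isTv .last) <|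
      .imp (.inCode hc4.lift.lift hd4.lift.lift (.conj hh'.lift hk'.lift) .last)
        (.inc hc4.lift.lift hd4.lift.lift .last UTerm.last.lift.lift)

theorem UDef.le (ht : UTerm t) (hs : UTerm s) : UDef fun G _ w => Le (t G w) (s G w) :=
  .ex <| .ex <| .and (.isCode UTerm.last.lift .last) <| .and (.not <| .bad UTerm.last.lift .last) <|
    .codeLe UTerm.last.lift .last ht.lift.lift hs.lift.lift

end Predicates

end Definability

/-! ### The interpretations -/

section Interpretations

open FirstOrder.Language (Structure)

/-- An interpretation of a relational structure in groups is given by uniformly definable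
relations. -/
theorem exists_interpretation {L : FirstOrder.Language.{0, 0}} [L.IsRelational] {n : ℕ} (hn : 0 < n)
    {dom : ∀ (G : Type v) [Group G], (Fin n → G) → Prop}
    {eqv : ∀ (G : Type v) [Group G], (Fin n ⊕ Fin n → G) → Prop}
    {rel : ∀ {k : ℕ}, L.Relations k → ∀ (G : Type v) [Group G], (Fin k × Fin n → G) → Prop}
    (hdom : UDef dom) (heqv : UDef eqv) (hrel : ∀ {k : ℕ} (R : L.Relations k), UDef (rel R)) :
    ∃ I : Interpretation L groupLang, ∀ (G : Type v) [Group G] (M : Type v) [L.Structure M]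
      (f : {a // dom G a} → M), Function.Surjective f →
      (∀ a b, eqv G (Sum.elim a.1 b.1) ↔ f a = f b) →
      (∀ {k : ℕ} (R : L.Relations k) (a : Fin k → {a // dom G a}),
        rel R G (fun p => (a p.1).1 p.2) ↔ Structure.RelMap R fun i => f (a i)) →
      I.Interprets M G := by
  obtain ⟨δ, hδ⟩ := hdom
  obtain ⟨ε, hε⟩ := heqv
  choose ρ hρ using @hrel
  refine ⟨⟨n, hn, δ, ε, ρ, fun F => isEmptyElim F⟩, fun G _ M _ f hf hfe hfr => ?_⟩
  refine ⟨fun a => f ⟨a.1, (hδ G a.1).1 a.2⟩, fun m => ?_, fun a b => ?_, fun k R a => ?_,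
    fun k F => isEmptyElim F⟩
  · obtain ⟨a, rfl⟩ := hf m
    exact ⟨⟨a.1, (hδ G a.1).2 a.2⟩, rfl⟩
  · exact (hε G _).trans (hfe ⟨a.1, _⟩ ⟨b.1, _⟩)
  · exact (hρ R G _).trans (hfr R fun i => ⟨(a i).1, (hδ G (a i).1).1 (a i).2⟩)

/-- Every element of the group is the code of the intersection of all hyperplanes fixed by it. -/
theorem exists_interpretation_projectiveSpace :
    ∃ J : Interpretation FirstOrder.Language.order groupLang,
      ∀ (D : Type u) [DivisionRing D] (V : Type v) [AddCommGroup V] [Module D V],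
        ¬ Module.Finite D V → J.Interprets (Submodule D V) (PGL D V) := by
  obtain ⟨J, hJ⟩ := exists_interpretation.{v} (L := FirstOrder.Language.order) (n := 1) one_pos
    (dom := fun G _ w => w 0 = w 0)
    (eqv := fun G _ w => Le (w (.inl 0)) (w (.inr 0)) ∧ Le (w (.inr 0)) (w (.inl 0)))
    (rel := fun {k} R => match k, R with
      | _, .le => fun G _ w => Le (w (0, 0)) (w (1, 0)))
    (.eq (.var _) (.var _)) (.and (.le (.var _) (.var _)) (.le (.var _) (.var _)))
    (fun {k} R => match k, R with
      | _, .le => .le (.var _) (.var _))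
  refine ⟨J, fun D _ V _ _ hV => hJ _ _ (fun a => fixInf (a.1 0)) (fun L => ?_) (fun a b => ?_)
    (fun {k} R a => ?_)⟩
  · obtain ⟨g, rfl⟩ := fixInf_surjective hV L
    exact ⟨⟨fun _ => g, rfl⟩, rfl⟩
  · rw [le_iff_fixInf_le hV, le_iff_fixInf_le hV]
    exact le_antisymm_iff.symm
  · cases R
    exact le_iff_fixInf_le hV _ _

instance : pgLang.IsRelational := fun _ => inferInstanceAs (IsEmpty Empty)

/-- The group element encodes a proper non-zero subspace: it is neither a least nor a greatest
element with respect to `Le`. -/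
def IsProper {G : Type*} [Group G] (k : G) : Prop := (∃ l, ¬ Le k l) ∧ ∃ l, ¬ Le l k

theorem UDef.isProper {α : Type} {t : ∀ (G : Type v) [Group G], (α → G) → G} (ht : UTerm t) :
    UDef fun G _ w => IsProper (t G w) :=
  .and (.ex <| .not <| .le ht.lift .last) (.ex <| .not <| .le .last ht.lift)

theorem isProper_iff {D V : Type*} [DivisionRing D] [AddCommGroup V] [Module D V]
    (hV : ¬ Module.Finite D V) (k : PGL D V) :
    IsProper k ↔ fixInf k ≠ ⊥ ∧ fixInf k ≠ ⊤ := by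
  simp only [IsProper, le_iff_fixInf_le hV]
  rw [← (fixInf_surjective hV).exists (p := fun L => ¬ fixInf k ≤ L),
    ← (fixInf_surjective hV).exists (p := fun L => ¬ L ≤ fixInf k), ← not_forall, ← not_forall,
    ne_eq, ne_eq]
  refine and_congr (not_congr ⟨fun h => ?_, fun h L => ?_⟩) (not_congr ⟨fun h => ?_, fun h L => ?_⟩)
  · exact le_bot_iff.1 (h ⊥)
  · rw [h]; exact bot_le
  · exact top_le_iff.1 (h ⊤)
  · rw [h]; exact le_top

/-- Equality of the subspaces encoded by two group elements. -/
def CodeEq {G : Type*} [Group G] (k l : G) : Prop := Le k l ∧ Le l k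

theorem UDef.codeEq {α : Type} {t s : ∀ (G : Type v) [Group G], (α → G) → G} (ht : UTerm t)
    (hs : UTerm s) : UDef fun G _ w => CodeEq (t G w) (s G w) :=
  .and (.le ht hs) (.le hs ht)

theorem codeEq_iff {D V : Type*} [DivisionRing D] [AddCommGroup V] [Module D V]
    (hV : ¬ Module.Finite D V) (k l : PGL D V) : CodeEq k l ↔ fixInf k = fixInf l := by
  rw [CodeEq, le_iff_fixInf_le hV, le_iff_fixInf_le hV]
  exact le_antisymm_iff.symm

/-- A pair `(g, 1)` is a code of the group element `g`. A pair `(k, t)` with `t ≠ 1` is a code of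
the intersection of all hyperplanes fixed by `k`. -/
noncomputable def decode {D V : Type*} [DivisionRing D] [AddCommGroup V] [Module D V]
    (a : Fin 2 → PGL D V)
    (ha : a 1 ≠ 1 → fixInf (a 0) ≠ ⊥ ∧ fixInf (a 0) ≠ ⊤) :
    PGL D V ⊕ PStar D V :=
  open Classical in
  if h : a 1 = 1 then Sum.inl (a 0) else Sum.inr ⟨fixInf (a 0), ha h⟩

section

variable {D V : Type*} [DivisionRing D] [AddCommGroup V] [Module D V]
  {a : Fin 2 → PGL D V} {ha : a 1 ≠ 1 → fixInf (a 0) ≠ ⊥ ∧ fixInf (a 0) ≠ ⊤}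

theorem decode_of_eq (h : a 1 = 1) : decode a ha = Sum.inl (a 0) := dif_pos h

theorem decode_of_ne (h : a 1 ≠ 1) : decode a ha = Sum.inr ⟨fixInf (a 0), ha h⟩ := dif_neg h

theorem decode_eq_inl_iff (g : PGL D V) : decode a ha = Sum.inl g ↔ a 1 = 1 ∧ a 0 = g := by
  by_cases h : a 1 = 1
  · rw [decode_of_eq h, Sum.inl.injEq, and_iff_right h]
  · rw [decode_of_ne h]
    exact ⟨fun e => (Sum.inr_ne_inl e).elim, fun e => (h e.1).elim⟩

theorem decode_eq_inr_iff (S : PStar D V) :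
    decode a ha = Sum.inr S ↔ a 1 ≠ 1 ∧ fixInf (a 0) = S.1 := by
  by_cases h : a 1 = 1
  · rw [decode_of_eq h]
    exact ⟨fun e => (Sum.inl_ne_inr e).elim, fun e => (e.1 h).elim⟩
  · rw [decode_of_ne h, and_iff_right h]
    exact Sum.inr_injective.eq_iff.trans Subtype.ext_iff

theorem decode_eq_decode_iff {b : Fin 2 → PGL D V}
    {hb : b 1 ≠ 1 → fixInf (b 0) ≠ ⊥ ∧ fixInf (b 0) ≠ ⊤} :
    decode a ha = decode b hb ↔
      (a 1 = 1 ∧ b 1 = 1 ∧ a 0 = b 0) ∨ (a 1 ≠ 1 ∧ b 1 ≠ 1 ∧ fixInf (a 0) = fixInf (b 0)) := by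
  by_cases h : b 1 = 1
  · rw [decode_of_eq (a := b) h]
    refine (decode_eq_inl_iff _).trans ?_
    tauto
  · rw [decode_of_ne (a := b) h]
    refine (decode_eq_inr_iff _).trans ?_
    tauto

end

/-- The relations between codes that define the basic relations of the two-sorted structure. -/
def codeRel : ∀ {k : ℕ}, PGRel k → ∀ (G : Type v) [Group G], (Fin k × Fin 2 → G) → Prop
  | _, .group, _, _, w => w (0, 1) = 1
  | _, .space, _, _, w => w (0, 1) ≠ 1
  | _, .comp, _, _, w =>
      w (0, 1) = 1 ∧ w (1, 1) = 1 ∧ w (2, 1) = 1 ∧ w (2, 0) = w (0, 0) * w (1, 0)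
  | _, .betw, _, _, w =>
      w (0, 1) ≠ 1 ∧ w (1, 1) ≠ 1 ∧ w (2, 1) ≠ 1 ∧
        ((Le (w (0, 0)) (w (1, 0)) ∧ Le (w (1, 0)) (w (2, 0))) ∨
          (Le (w (1, 0)) (w (0, 0)) ∧ Le (w (2, 0)) (w (1, 0))))
  | _, .act, _, _, w =>
      w (0, 1) = 1 ∧ w (1, 1) ≠ 1 ∧ w (2, 1) ≠ 1 ∧
        CodeEq (w (0, 0) * w (1, 0) * (w (0, 0))⁻¹) (w (2, 0))

theorem UDef.codeRel {k : ℕ} (R : PGRel k) : UDef (codeRel.{v} R) :=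
  match k, R with
  | _, .group => .eq (.var _) .one
  | _, .space => .ne (.var _) .one
  | _, .comp => .and (.eq (.var _) .one) <| .and (.eq (.var _) .one) <|
      .and (.eq (.var _) .one) (.eq (.var _) (.mul (.var _) (.var _)))
  | _, .betw => .and (.ne (.var _) .one) <| .and (.ne (.var _) .one) <|
      .and (.ne (.var _) .one) <| .or
        (.and (.le (.var _) (.var _)) (.le (.var _) (.var _)))
        (.and (.le (.var _) (.var _)) (.le (.var _) (.var _)))
  | _, .act => .and (.eq (.var _) .one) <| .and (.ne (.var _) .one) <|
      .and (.ne (.var _) .one) (.codeEq (.conj (.var _) (.var _)) (.var _))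

theorem codeRel_iff {D V : Type*} [DivisionRing D] [AddCommGroup V] [Module D V]
    (hV : ¬ Module.Finite D V) {k : ℕ} (R : PGRel k) (a : Fin k → Fin 2 → PGL D V)
    (ha : ∀ i, a i 1 ≠ 1 → fixInf (a i 0) ≠ ⊥ ∧ fixInf (a i 0) ≠ ⊤) :
    codeRel R (PGL D V) (fun p => a p.1 p.2) ↔
      Structure.RelMap (L := pgLang) (M := PG D V) R fun i => decode (a i) (ha i) := by
  cases R with
  | group =>
    change a 0 1 = 1 ↔ ∃ g, decode (a 0) (ha 0) = Sum.inl g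
    simp only [decode_eq_inl_iff]
    exact ⟨fun h => ⟨_, h, rfl⟩, fun ⟨_, h, _⟩ => h⟩
  | space =>
    change a 0 1 ≠ 1 ↔ ∃ S, decode (a 0) (ha 0) = Sum.inr S
    simp only [decode_eq_inr_iff]
    exact ⟨fun h => ⟨⟨_, ha 0 h⟩, h, rfl⟩, fun ⟨_, h, _⟩ => h⟩
  | comp =>
    change (a 0 1 = 1 ∧ a 1 1 = 1 ∧ a 2 1 = 1 ∧ a 2 0 = a 0 0 * a 1 0) ↔
      ∃ g h, decode (a 0) (ha 0) = Sum.inl g ∧ decode (a 1) (ha 1) = Sum.inl h ∧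
        decode (a 2) (ha 2) = Sum.inl (g * h)
    simp only [decode_eq_inl_iff]
    constructor
    · rintro ⟨h0, h1, h2, h⟩
      exact ⟨_, _, ⟨h0, rfl⟩, ⟨h1, rfl⟩, h2, h⟩
    · rintro ⟨g, h, ⟨h0, rfl⟩, ⟨h1, rfl⟩, h2, h3⟩
      exact ⟨h0, h1, h2, h3⟩
  | betw =>
    change (a 0 1 ≠ 1 ∧ a 1 1 ≠ 1 ∧ a 2 1 ≠ 1 ∧
        ((Le (a 0 0) (a 1 0) ∧ Le (a 1 0) (a 2 0)) ∨ (Le (a 1 0) (a 0 0) ∧ Le (a 2 0) (a 1 0)))) ↔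
      ∃ S₀ S₁ S₂, decode (a 0) (ha 0) = Sum.inr S₀ ∧ decode (a 1) (ha 1) = Sum.inr S₁ ∧
        decode (a 2) (ha 2) = Sum.inr S₂ ∧ Between S₀ S₁ S₂
    simp only [decode_eq_inr_iff, le_iff_fixInf_le hV]
    constructor
    · rintro ⟨h0, h1, h2, h⟩
      exact ⟨⟨_, ha 0 h0⟩, ⟨_, ha 1 h1⟩, ⟨_, ha 2 h2⟩, ⟨h0, rfl⟩, ⟨h1, rfl⟩, ⟨h2, rfl⟩, h⟩
    · rintro ⟨S₀, S₁, S₂, ⟨h0, e0⟩, ⟨h1, e1⟩, ⟨h2, e2⟩, h⟩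
      rw [e0, e1, e2]
      exact ⟨h0, h1, h2, h⟩
  | act =>
    change (a 0 1 = 1 ∧ a 1 1 ≠ 1 ∧ a 2 1 ≠ 1 ∧ CodeEq (a 0 0 * a 1 0 * (a 0 0)⁻¹) (a 2 0)) ↔
      ∃ g S T, decode (a 0) (ha 0) = Sum.inl g ∧ decode (a 1) (ha 1) = Sum.inr S ∧
        decode (a 2) (ha 2) = Sum.inr T ∧ g.1 S.1 = T.1
    simp only [decode_eq_inl_iff, decode_eq_inr_iff, codeEq_iff hV, fixInf_conj]
    constructor
    · rintro ⟨h0, h1, h2, h⟩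
      exact ⟨_, ⟨_, ha 1 h1⟩, ⟨_, ha 2 h2⟩, ⟨h0, rfl⟩, ⟨h1, rfl⟩, ⟨h2, rfl⟩, h⟩
    · rintro ⟨_, S, T, ⟨h0, rfl⟩, ⟨h1, e1⟩, ⟨h2, e2⟩, h⟩
      rw [e1, e2]
      exact ⟨h0, h1, h2, h⟩

theorem exists_interpretation_twoSorted :
    ∃ I : Interpretation pgLang groupLang,
      ∀ (D : Type u) [DivisionRing D] (V : Type v) [AddCommGroup V] [Module D V],
        ¬ Module.Finite D V → I.Interprets (PG D V) (PGL D V) := by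
  obtain ⟨I, hI⟩ := exists_interpretation.{v} (L := pgLang) (n := 2) two_pos
    (dom := fun G _ w => w 1 ≠ 1 → IsProper (w 0))
    (eqv := fun G _ w =>
      (w (.inl 1) = 1 ∧ w (.inr 1) = 1 ∧ w (.inl 0) = w (.inr 0)) ∨
        (w (.inl 1) ≠ 1 ∧ w (.inr 1) ≠ 1 ∧ CodeEq (w (.inl 0)) (w (.inr 0))))
    (rel := fun R => codeRel R)
    (.imp (.ne (.var _) .one) (.isProper (.var _)))
    (.or (.and (.eq (.var _) .one) <| .and (.eq (.var _) .one) (.eq (.var _) (.var _)))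
      (.and (.ne (.var _) .one) <| .and (.ne (.var _) .one) (.codeEq (.var _) (.var _))))
    (fun R => .codeRel R)
  refine ⟨I, fun D _ V _ _ hV => hI _ _
    (fun a => decode a.1 fun h => (isProper_iff hV _).1 (a.2 h)) (fun m => ?_) (fun a b => ?_)
    (fun R a => codeRel_iff hV R (fun i => (a i).1) _)⟩
  · rcases m with g | S
    · exact ⟨⟨![g, 1], fun h => (h rfl).elim⟩, (decode_eq_inl_iff g).2 ⟨rfl, rfl⟩⟩
    · obtain ⟨k, hk⟩ := fixInf_surjective hV S.1
      obtain ⟨φ, v, hφ, hv, h⟩ := exists_tv_data (D := D) (V := V) hV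
      refine ⟨⟨![k, proj (tv φ v)], fun _ => (isProper_iff hV _).2 ?_⟩,
        (decode_eq_inr_iff S).2 ⟨proj_tv_ne_one hφ hv h, hk⟩⟩
      change fixInf k ≠ ⊥ ∧ fixInf k ≠ ⊤
      rw [hk]
      exact S.2
  · refine Iff.trans ?_ decode_eq_decode_iff.symm
    rw [← codeEq_iff hV]
    rfl

end Interpretations
end ProjRec

theorem mainTheorem4 :
    (∃ I : ProjRec.Interpretation ProjRec.pgLang ProjRec.groupLang,
      ∀ (D : Type u) [DivisionRing D] (V : Type v) [AddCommGroup V] [Module D V],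
        ¬ Module.Finite D V → I.Interprets (ProjRec.PG D V) (ProjRec.PGL D V)) ∧
    (∃ J : ProjRec.Interpretation FirstOrder.Language.order ProjRec.groupLang,
      ∀ (D : Type u) [DivisionRing D] (V : Type v) [AddCommGroup V] [Module D V],
        ¬ Module.Finite D V → J.Interprets (Submodule D V) (ProjRec.PGL D V)) :=
  ⟨ProjRec.exists_interpretation_twoSorted, ProjRec.exists_interpretation_projectiveSpace⟩
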